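/- **Setting.** Let $\phi:[0,\infty)\times[0,\infty)\to[0,\infty)$, $(x,t)\mapsto\phi(x,t)=\phi_x(t)$, be a $\mathcal C^1$ semiflow: $\phi(x,t+s)=\phi(\phi(x,s),t)$ for all $x,s,t\ge 0$; $\phi(\cdot,t)$ is a homeomorphism of $[0,\infty)$ onto its image for each $t\ge 0$; and $\phi_x$ is a $\mathcal C^1$-diffeomorphism of $[0,\infty)$ onto $[x,\infty)$ for each $x>0$. Let $f:[0,\infty)\to[0,\infty)$ be an increasing $\mathcal C^1$-diffeomorphism, and let $g_x=\big[(f\circ\phi_x)^{-1}\big]'$ on $[f(x),\infty)$ for $x>0$. Assume that there are $0<\kappa<1$ and continuous functions $\mathbf m,\mathbf M:(0,\infty)\to(0,\infty)$ with $\mathbf m\le\mathbf M$ such that $$0<f(x)\le\kappa x\quad(x>0),\qquad \mathbf m(y)\le g_x(y)\le\mathbf M(y)\quad(x>0,\ y\ge f(x)).$$ Let $b>0$ and let $\mathfrak c=(r,L,\mathbf a)$ be a vector of positive constants with $$r\ge f^{-1}\!\left(\left[\frac{-\ln(1-\kappa^{b+1})}{1-\kappa^{b+1}}\right]^{1/(b+1)}\right).$$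 Let $\mathcal F(\mathfrak c,b)$ be the class of continuous functions $\lambda:[0,\infty)\to[0,\infty)$ such that $$\frac{f(x)^b}{\mathbf m(f(x))}\le\frac{\lambda(x)}{\mathbf a}\quad\text{for all }x\ge r,\qquad \int_0^{f(r)}\mathbf M(u)\,\lambda(f^{-1}(u))\,du\le L,$$ where the integrand of the last integral is required to be integrable. For $\lambda\in\mathcal F(\mathfrak c,b)$ and $x_0\ge 0$, consider the piecewise deterministic Markov process with flow $\phi$, jump rate $\lambda$ and jump map $f$ started at $x_0$, and its jump chain $(Z_n)_{n\ge 0}$: $Z_0=x_0$ and $Z_{n+1}=f(\phi(Z_n,S_{n+1}))$, where, conditionally on the past, the waiting time $S_{n+1}$ satisfies $\mathbb P(S_{n+1}>t)=\exp\big(-\int_0^t\lambda(\phi(Z_n,s))\,ds\big)$ for $t\ge 0$. (The waiting time is almost surely finite, except when $x_0=0$ is a rest point of the flow and $\lambda(0)=0$, in which case we put $Z_n=0$ for all $n$.) Let $\mathcal O_a^b=\sigma(Z_j:\ a\le j\le b)$. The $\beta$-mixing coefficient of the chain is $$\beta_Z(t)=\sup_{k\ge 0}\ \sup_{E\in\mathcal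 O_0^k\otimes\mathcal O_{t+k}^\infty}\big|P_{\mathcal O_0^k\otimes\mathcal O_{t+k}^\infty}(E)-P_{\mathcal O_0^k}\otimes P_{\mathcal O_{t+k}^\infty}(E)\big|,\qquad t\in\mathbb N,$$ where $P_{\mathcal O_0^k\otimes\mathcal O_{t+k}^\infty}$ is the image of $\mathbb P$ under $\omega\mapsto(\omega,\omega)$. The chain is called geometrically $\beta$-mixing if there are $c,\beta>0$ with $\beta_Z(t)\le c\,e^{-\beta t}$ for all $t\in\mathbb N$. **Statement.** There is a constant $\gamma\in(0,1)$, which depends neither on $\lambda\in\mathcal F(\mathfrak c,b)$ nor on $x_0$, such that for each starting point $x_0\ge 0$: for each $\lambda\in\mathcal F(\mathfrak c,b)$ the jump chain $(Z_n)$ started at $x_0$ is geometrically $\beta$-mixing; and there is a constant $c>0$, which depends on $x_0$ but not on $\lambda$, such that for all $t\in\mathbb N$ $$\sup_{\lambda\in\mathcal F(\mathfrak c,b)}\beta_Z(t)\le c\,\gamma^t.$$ -/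

import Mathlib

open Set MeasureTheory ProbabilityTheory
open scoped ENNReal

noncomputable section

namespace PDMP

/-- The inverse of a function `h` on `[0,∞)` (only used on the image `h '' [0,∞)`). -/
def inv (h : ℝ → ℝ) : ℝ → ℝ := Function.invFunOn h (Ici 0)

/-- `h` is a `C¹`-diffeomorphism of `[0,∞)` onto `t` (with one-sided derivatives at end points). -/
structure IsC1Diffeo (h : ℝ → ℝ) (t : Set ℝ) : Prop where
  bijOn : BijOn h (Ici 0) t
  contDiffOn : ContDiffOn ℝ 1 h (Ici 0)
  contDiffOn_inv : ContDiffOn ℝ 1 (inv h) t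

/-- The local characteristics: a `C¹` semiflow `φ` on `[0,∞)`, given by homeomorphisms onto their
images, and a jump map `f`. Functions on `[0,∞)` are functions on `ℝ` whose values at negative
arguments are irrelevant. Each trajectory `φ_x` with `x > 0` is a `C¹`-diffeomorphism of `[0,∞)`
onto `[x,∞)`; the origin may be a rest point, as for `φ(x,t) = x e^{ct}`. -/
structure IsCharacteristics (φ : ℝ → ℝ → ℝ) (f : ℝ → ℝ) : Prop where
  flow_nonneg : ∀ x ≥ 0, ∀ t ≥ 0, 0 ≤ φ x t
  flow_contDiffOn : ContDiffOn ℝ 1 (fun p : ℝ × ℝ => φ p.1 p.2) (Ici 0 ×ˢ Ici 0)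
  flow_isEmbedding : ∀ t ≥ 0, Topology.IsEmbedding (fun x : Ici (0 : ℝ) => φ x t)
  flow_add : ∀ x ≥ 0, ∀ s ≥ 0, ∀ t ≥ 0, φ x (t + s) = φ (φ x s) t
  flow_diffeo : ∀ x > 0, IsC1Diffeo (φ x) (Ici x)
  jump_diffeo : IsC1Diffeo f (Ici 0)
  jump_strictMonoOn : StrictMonoOn f (Ici 0)

/-- `g_x(y)`, the derivative at `y` of `(f ∘ φ_x)⁻¹ : [f(x),∞) → [0,∞)`. -/
def g (φ : ℝ → ℝ → ℝ) (f : ℝ → ℝ) (x y : ℝ) : ℝ :=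
  derivWithin (inv (fun t => f (φ x t))) (Ici (f x)) y

/-- The constraints on `f` and `φ`: `0 < f(x) ≤ κ x`, and `m ≤ g_x ≤ M` on the domain `[f(x),∞)`
of `g_x`, for two positive continuous functions `m ≤ M`. -/
structure IsConstrained (φ : ℝ → ℝ → ℝ) (f m M : ℝ → ℝ) (κ : ℝ) : Prop where
  kappa_pos : 0 < κ
  kappa_lt_one : κ < 1
  jump_pos : ∀ x > 0, 0 < f x
  jump_le : ∀ x > 0, f x ≤ κ * x
  m_continuousOn : ContinuousOn m (Ioi 0)
  M_continuousOn : ContinuousOn M (Ioi 0)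
  m_pos : ∀ y > 0, 0 < m y
  m_le_M : ∀ y > 0, m y ≤ M y
  m_le_g : ∀ x > 0, ∀ y ≥ f x, m y ≤ g φ f x y
  g_le_M : ∀ x > 0, ∀ y ≥ f x, g φ f x y ≤ M y

/-- The class `𝓕(𝔠, b)` of jump rates, where `𝔠 = (r, L, a)`. -/
structure RateClass (f m M : ℝ → ℝ) (r L a b : ℝ) (lam : ℝ → ℝ) : Prop where
  continuousOn : ContinuousOn lam (Ici 0)
  nonneg : ∀ x ≥ 0, 0 ≤ lam x
  lower_bound : ∀ x ≥ r, f x ^ b / m (f x) ≤ lam x / a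
  integrableOn : IntegrableOn (fun u => M u * lam (inv f u)) (Ioc 0 (f r))
  integral_le : ∫ u in (0 : ℝ)..f r, M u * lam (inv f u) ≤ L

/-- The cumulated jump rate `Λ(x,t) = ∫₀ᵗ λ(φ(x,s)) ds`. -/
def cumRate (φ : ℝ → ℝ → ℝ) (lam : ℝ → ℝ) (x t : ℝ) : ℝ :=
  ∫ s in (0 : ℝ)..t, lam (φ x s)

/-- The waiting time before the next jump from position `x`, as a function of a standard
exponential variable `e`: the first `t ≥ 0` with `Λ(x,t) ≥ e`. Thus it exceeds `t` exactly when
`e > Λ(x,t)`, which has probability `exp(-Λ(x,t))`. -/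
def waitingTime (φ : ℝ → ℝ → ℝ) (lam : ℝ → ℝ) (x e : ℝ) : ℝ :=
  sInf {t : ℝ | 0 ≤ t ∧ e ≤ cumRate φ lam x t}

/-- The exponential distribution with parameter `1`, as a probability measure. -/
instance : IsProbabilityMeasure (expMeasure 1) := isProbabilityMeasure_expMeasure one_pos

/-- The law of a sequence of independent standard exponential variables, which drives the process. -/
def driving : Measure (ℕ → ℝ) := Measure.infinitePi (fun _ => expMeasure 1)

/-- The jump chain `Z_n = X(T_n)` started at `x₀`: from `Z_n`, the process follows the flow during
the waiting time `T_{n+1} - T_n`, then jumps by `f`. -/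
def jumpChain (φ : ℝ → ℝ → ℝ) (f lam : ℝ → ℝ) (x₀ : ℝ) : ℕ → (ℕ → ℝ) → ℝ
  | 0, _ => x₀
  | n + 1, ω =>
    f (φ (jumpChain φ f lam x₀ n ω) (waitingTime φ lam (jumpChain φ f lam x₀ n ω) (ω n)))

/-- The σ-algebra `O_a^b` generated by the `Z_j` with `a ≤ j ≤ b`. -/
@[reducible] def sigmaBetween {Ω : Type*} (Z : ℕ → Ω → ℝ) (a : ℕ) (b : ℕ∞) : MeasurableSpace Ω :=
  ⨆ j : {j : ℕ // a ≤ j ∧ (j : ℕ∞) ≤ b}, MeasurableSpace.comap (Z j) (borel ℝ)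

/-- The `β`-mixing coefficient: the supremum over `k` and over `E ∈ O_0^k ⊗ O_{t+k}^∞` of the
difference between the joint law (the image of `P` under `ω ↦ (ω, ω)`) and the product law
(`P ⊗ P`, whose restriction to `O_0^k ⊗ O_{t+k}^∞` is the product of the restrictions of `P`). -/
def betaCoeff {Ω : Type*} [MeasurableSpace Ω] (P : Measure Ω) (Z : ℕ → Ω → ℝ) (t : ℕ) : ℝ≥0∞ :=
  ⨆ (k : ℕ) (E : Set (Ω × Ω))
    (_ : MeasurableSet[(sigmaBetween Z 0 k).prod (sigmaBetween Z (t + k) ⊤)] E),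
    ENNReal.ofReal |P.real {ω | (ω, ω) ∈ E} - (P.prod P).real E|

/-- Geometric `β`-mixing: `β_Z(t) ≤ c e^{-β t}` for some constants `c` and `β > 0`. -/
def IsGeometricallyBetaMixing {Ω : Type*} [MeasurableSpace Ω] (P : Measure Ω)
    (Z : ℕ → Ω → ℝ) : Prop :=
  ∃ c > 0, ∃ β > 0, ∀ t : ℕ, betaCoeff P Z t ≤ ENNReal.ofReal (c * Real.exp (-β * t))

end PDMP

end

/-!
Along the flow, the cumulated jump rate is the increment of a function `C` (the hazard) of the
position `y` after a jump. Hence, in terms of a standard exponential variable `e`, the jump chain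
is the recursion `x ↦ q (C (f x) + e)`, where `q` is the left inverse of `C`. As `f x ≤ κ x` and
`C` grows at least like `θ y ^ p`, with `p = b + 1` and `θ = a / (b + 1)`, the function
`V x = θ (max x r) ^ p` evolves below the recursion `v ↦ max v₀ (κ ^ p v + e)`, with
`v₀ = θ r ^ p`. Two bottom states `V x, V y ≤ v₀` have levels `C (f x)`, `C (f y)` at distance at
most `L`, and the lack of memory of `e` couples their steps with probability at least `exp (-L)`.
A weight `w` with `w ≥ 1`, which the recursion of `V` contracts above `v₀` and which the coupling
contracts at the bottom, turns this into the bound `|P_x(S) - P_y(S)| ≤ γ ^ t w (max (V x) (V y))`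
for the laws of the chain after time `t`, with constants that involve the jump rate only through
`(r, L, a)`.
-/

namespace PDMP

section ExponentialLaw

variable {r : ℝ}

theorem expMeasure_eq_withDensity (r : ℝ) :
    expMeasure r = (volume.restrict (Ioi (0 : ℝ))).withDensity
      fun x => ENNReal.ofReal (r * Real.exp (-(r * x))) := by
  have h : expMeasure r = volume.withDensity (exponentialPDF r) := rfl
  rw [h, restrict_Ioi_eq_restrict_Ici, ← withDensity_indicator measurableSet_Ici]
  congr with x
  by_cases hx : 0 ≤ x <;> simp [exponentialPDF_eq, hx]

theorem ae_pos_expMeasure (r : ℝ) : ∀ᵐ e ∂expMeasure r, 0 < e := by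
  rw [expMeasure_eq_withDensity]
  exact (withDensity_absolutelyContinuous _ _).ae_le (ae_restrict_mem measurableSet_Ioi)

theorem integral_expMeasure (hr : 0 < r) (F : ℝ → ℝ) :
    ∫ e, F e ∂expMeasure r = ∫ x in Ioi (0 : ℝ), r * Real.exp (-(r * x)) * F x := by
  rw [expMeasure_eq_withDensity,
    integral_withDensity_eq_integral_toReal_smul (by fun_prop) (by simp)]
  simp [ENNReal.toReal_ofReal (mul_nonneg hr.le (Real.exp_nonneg _))]

theorem integrable_expMeasure_iff (hr : 0 < r) (F : ℝ → ℝ) :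
    Integrable F (expMeasure r) ↔
      IntegrableOn (fun x => r * Real.exp (-(r * x)) * F x) (Ioi 0) := by
  rw [expMeasure_eq_withDensity,
    integrable_withDensity_iff_integrable_smul' (by fun_prop) (by simp)]
  simp [ENNReal.toReal_ofReal (mul_nonneg hr.le (Real.exp_nonneg _)), IntegrableOn]

theorem integrable_id_expMeasure (hr : 0 < r) : Integrable (fun e : ℝ => e) (expMeasure r) := by
  rw [integrable_expMeasure_iff hr]
  have h := (integrableOn_rpow_mul_exp_neg_mul_rpow (s := 1) (p := 1) (by norm_num) one_pos
    hr).const_mul r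
  refine IntegrableOn.congr_fun h (fun x _ => ?_) measurableSet_Ioi
  simp only [Real.rpow_one, neg_mul]
  ring

theorem integral_id_expMeasure (hr : 0 < r) : ∫ e, e ∂expMeasure r = r⁻¹ := by
  rw [integral_expMeasure hr]
  have h := Real.integral_rpow_mul_exp_neg_mul_Ioi (a := 2) (r := r) (by norm_num) hr
  rw [Real.Gamma_two, mul_one] at h
  calc ∫ x in Ioi (0 : ℝ), r * Real.exp (-(r * x)) * x
      = r * ∫ x in Ioi (0 : ℝ), x ^ ((2 : ℝ) - 1) * Real.exp (-(r * x)) := by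
        rw [← integral_const_mul]
        refine setIntegral_congr_fun measurableSet_Ioi fun x _ => ?_
        norm_num
        ring
    _ = r⁻¹ := by
        rw [h, Real.rpow_two]
        field_simp

theorem integrable_exp_neg_mul_expMeasure (hr : 0 < r) {B : ℝ} (hB : -r < B) :
    Integrable (fun e => Real.exp (-(B * e))) (expMeasure r) := by
  rw [integrable_expMeasure_iff hr]
  have h := (integrableOn_exp_mul_Ioi (a := -(r + B)) (by linarith) 0).const_mul r
  refine IntegrableOn.congr_fun h (fun x _ => ?_) measurableSet_Ioi
  rw [mul_assoc, ← Real.exp_add]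
  ring_nf

theorem integral_exp_neg_mul_expMeasure (hr : 0 < r) {B : ℝ} (hB : -r < B) :
    ∫ e, Real.exp (-(B * e)) ∂expMeasure r = r / (r + B) := by
  rw [integral_expMeasure hr]
  have h := integral_exp_mul_Ioi (a := -(r + B)) (by linarith) 0
  rw [mul_zero, Real.exp_zero, neg_div_neg_eq] at h
  rw [div_eq_mul_one_div, ← h, ← integral_const_mul]
  refine setIntegral_congr_fun measurableSet_Ioi fun x _ => ?_
  simp only [mul_assoc, ← Real.exp_add]
  ring_nf

theorem setIntegral_Ioi_expMeasure (hr : 0 < r) (F : ℝ → ℝ) {d : ℝ} (hd : 0 ≤ d) :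
    ∫ e in Ioi d, F e ∂expMeasure r =
      Real.exp (-(r * d)) * ∫ e, F (d + e) ∂expMeasure r := by
  have h : (fun x => r * Real.exp (-(r * x)) * (Ioi d).indicator F x) =
      (Ioi d).indicator fun x => r * Real.exp (-(r * x)) * F x :=
    funext fun x => (indicator_mul_right _ (fun x => r * Real.exp (-(r * x))) F).symm
  rw [← integral_indicator measurableSet_Ioi, integral_expMeasure hr, integral_expMeasure hr,
    ← integral_const_mul, h, setIntegral_indicator measurableSet_Ioi, Ioi_inter_Ioi,
    max_eq_right hd,
    ← (measurePreserving_add_left volume d).setIntegral_preimage_emb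
      (measurableEmbedding_addLeft d), preimage_const_add_Ioi, sub_self]
  refine integral_congr_ae (.of_forall fun x => ?_)
  simp only [mul_add, neg_add, Real.exp_add]
  ring

theorem integral_expMeasure_eq_add (hr : 0 < r) {F : ℝ → ℝ} (hF : Integrable F (expMeasure r))
    {d : ℝ} (hd : 0 ≤ d) :
    ∫ e, F e ∂expMeasure r = ∫ e in Iic d, F e ∂expMeasure r +
      Real.exp (-(r * d)) * ∫ e, F (d + e) ∂expMeasure r := by
  rw [← setIntegral_Ioi_expMeasure hr F hd, ← compl_Iic, integral_add_compl measurableSet_Iic hF]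

theorem measureReal_Iic_expMeasure (hr : 0 < r) {d : ℝ} (hd : 0 ≤ d) :
    (expMeasure r).real (Iic d) = 1 - Real.exp (-(r * d)) := by
  have := isProbabilityMeasure_expMeasure hr
  rw [← cdf_eq_real, cdf_expMeasure_eq hr, if_pos hd]

/- An exponential variable exceeds `d` with probability `exp (-(r * d))` and is then distributed as
`d + e`, so that it can be coupled with `d + e'` except on an event of the remaining probability. -/
theorem abs_integral_sub_integral_const_add_le (hr : 0 < r) {F : ℝ → ℝ}
    (hF : Integrable F (expMeasure r)) {d : ℝ} (hd : 0 ≤ d) {B : ℝ}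
    (hB : ∀ e ≤ d, |F e - ∫ e', F (d + e') ∂expMeasure r| ≤ B) :
    |∫ e, F e ∂expMeasure r - ∫ e, F (d + e) ∂expMeasure r| ≤
      (1 - Real.exp (-(r * d))) * B := by
  have := isProbabilityMeasure_expMeasure hr
  set K := ∫ e, F (d + e) ∂expMeasure r
  have h : ∫ e, F e ∂expMeasure r - K = ∫ e in Iic d, (F e - K) ∂expMeasure r := by
    rw [integral_expMeasure_eq_add hr hF hd, integral_sub hF.integrableOn (integrable_const _),
      setIntegral_const, measureReal_Iic_expMeasure hr hd, smul_eq_mul]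
    ring
  rw [h, ← Real.norm_eq_abs, ← measureReal_Iic_expMeasure hr hd, mul_comm]
  exact norm_setIntegral_le_of_norm_le_const (measure_lt_top _ _) hB

end ExponentialLaw

section Weights

variable {ε B ρ v₀ L δ η : ℝ}

/-- The function `v ↦ 1 + ε v - exp (-B v)`. Along the recursion `v ↦ ρ v + e` with `e` standard
exponential, the linear term provides the drift for large `v`; the exponential term, with `B` large
and `ε` small, provides it for the remaining `v`. -/
noncomputable def potential (ε B v : ℝ) : ℝ := 1 + ε * v - Real.exp (-(B * v))

theorem monotone_potential (hε : 0 ≤ ε) (hB : 0 ≤ B) : Monotone (potential ε B) := by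
  intro x y hxy
  unfold potential
  gcongr

theorem potential_nonneg (hε : 0 ≤ ε) (hB : 0 ≤ B) {v : ℝ} (hv : 0 ≤ v) :
    0 ≤ potential ε B v := by
  simpa [potential] using monotone_potential hε hB hv

theorem potential_le (ε B v : ℝ) : potential ε B v ≤ 1 + ε * v := by
  unfold potential
  linarith [Real.exp_pos (-(B * v))]

theorem potential_add (ε B c e : ℝ) :
    potential ε B (c + e) = 1 + ε * c + ε * e - Real.exp (-(B * c)) * Real.exp (-(B * e)) := by
  rw [potential, ← Real.exp_add]
  ring_nf

theorem integrable_potential_add (hB : -1 < B) (c : ℝ) :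
    Integrable (fun e => potential ε B (c + e)) (expMeasure 1) := by
  simp only [potential_add]
  exact ((integrable_const _).add ((integrable_id_expMeasure one_pos).const_mul ε)).sub
    ((integrable_exp_neg_mul_expMeasure one_pos hB).const_mul _)

theorem integral_potential_add (hB : -1 < B) (c : ℝ) :
    ∫ e, potential ε B (c + e) ∂expMeasure 1 =
      1 + ε * (c + 1) - Real.exp (-(B * c)) / (1 + B) := by
  have hid : Integrable (fun e : ℝ => ε * e) (expMeasure 1) :=
    (integrable_id_expMeasure one_pos).const_mul ε
  have haffine : Integrable (fun e : ℝ => 1 + ε * c + ε * e) (expMeasure 1) :=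
    (integrable_const _).add hid
  simp only [potential_add]
  rw [integral_sub haffine ((integrable_exp_neg_mul_expMeasure one_pos hB).const_mul _),
    integral_add (integrable_const _) hid, integral_const_mul, integral_const_mul,
    integral_id_expMeasure one_pos, integral_exp_neg_mul_expMeasure one_pos hB, integral_const,
    probReal_univ, one_smul]
  ring

theorem exists_two_mul_one_add_le_exp_mul {k : ℝ} (hk : 0 < k) :
    ∃ B > 0, 2 * (1 + B) ≤ Real.exp (B * k) := by
  have hcoeff : 0 < 8 / k ^ 2 := by positivity
  refine ⟨1 + 8 / k ^ 2, by positivity, ?_⟩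
  have hexp := Real.quadratic_le_exp_of_nonneg (x := (1 + 8 / k ^ 2) * k) (by positivity)
  have hsq : ((1 + 8 / k ^ 2) * k) ^ 2 = (1 + 8 / k ^ 2) * (k ^ 2 + 8) := by field_simp
  rw [hsq] at hexp
  nlinarith [mul_nonneg hcoeff.le (sq_nonneg k), sq_nonneg k, mul_nonneg hcoeff.le hk.le]

theorem exp_neg_mul_le_of_two_mul_le (hB : 0 < B) (hρ1 : ρ ≤ 1)
    (hexp : 2 * (1 + B) ≤ Real.exp (B * ((1 - ρ) * v₀))) {v : ℝ} (hv : v₀ ≤ v) :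
    Real.exp (-(B * v)) ≤ Real.exp (-(B * (ρ * v))) / (2 * (1 + B)) := by
  rw [le_div_iff₀ (by positivity)]
  calc Real.exp (-(B * v)) * (2 * (1 + B))
      ≤ Real.exp (-(B * v)) * Real.exp (B * ((1 - ρ) * v)) := by
        refine mul_le_mul_of_nonneg_left (hexp.trans ?_) (Real.exp_nonneg _)
        have := sub_nonneg.2 hρ1
        gcongr
    _ = Real.exp (-(B * (ρ * v))) := by rw [← Real.exp_add]; ring_nf

theorem exists_potential_drift (hρ : 0 ≤ ρ) (hρ1 : ρ < 1) (hv₀ : 0 < v₀) :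
    ∃ B > 0, ∃ ε > 0, ∃ η > 0, ∀ v ≥ v₀,
      ∫ e, potential ε B (ρ * v + e) ∂expMeasure 1 ≤ potential ε B v - η * (1 + ε * v) := by
  have hρ' : 0 < 1 - ρ := sub_pos.2 hρ1
  obtain ⟨B, hB, hexp⟩ := exists_two_mul_one_add_le_exp_mul (mul_pos hρ' hv₀)
  set v₁ := 3 / (1 - ρ)
  have hv₁ : (1 - ρ) * v₁ = 3 := mul_div_cancel₀ _ hρ'.ne'
  set c := Real.exp (-(B * (ρ * v₁))) / (2 * (1 + B))
  have hc : 0 < c := by positivity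
  refine ⟨B, hB, c / 2, by positivity, min (c / 4) ((1 - ρ) / 2),
    lt_min (by positivity) (by positivity), fun v hv => ?_⟩
  rw [integral_potential_add (by linarith), potential]
  set η := min (c / 4) ((1 - ρ) / 2)
  have hη : η ≤ c / 4 := min_le_left _ _
  have hv0 : 0 < v := hv₀.trans_le hv
  have hcv : 0 < c * v := by positivity
  have hηcv : η * (c * v) ≤ (1 - ρ) / 2 * (c * v) :=
    mul_le_mul_of_nonneg_right (min_le_right _ _) hcv.le
  have hsmall := exp_neg_mul_le_of_two_mul_le hB hρ1.le hexp hv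
  have htwice : Real.exp (-(B * (ρ * v))) / (1 + B) =
      2 * (Real.exp (-(B * (ρ * v))) / (2 * (1 + B))) := by field_simp
  have hpos : 0 ≤ Real.exp (-(B * (ρ * v))) / (2 * (1 + B)) := by positivity
  rw [htwice]
  rcases le_total v v₁ with hle | hge
  · have : c ≤ Real.exp (-(B * (ρ * v))) / (2 * (1 + B)) := by
      dsimp only [c]
      gcongr
    nlinarith
  · have : c * 3 ≤ c * ((1 - ρ) * v) := by
      rw [← hv₁]
      gcongr
    nlinarith

/-- The weight equal to `1` on the bottom states `v ≤ v₀` and to `1 + δ u` above them. -/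
noncomputable def weight (δ : ℝ) (u : ℝ → ℝ) (v₀ v : ℝ) : ℝ := if v ≤ v₀ then 1 else 1 + δ * u v

theorem one_le_weight {u : ℝ → ℝ} (hδ : 0 ≤ δ) (hu : ∀ v > v₀, 0 ≤ u v) (v : ℝ) :
    1 ≤ weight δ u v₀ v := by
  unfold weight
  split_ifs with hv
  · exact le_rfl
  · exact le_add_of_nonneg_right (mul_nonneg hδ (hu v (not_le.1 hv)))

theorem monotone_weight {u : ℝ → ℝ} (hδ : 0 ≤ δ) (hu : ∀ v > v₀, 0 ≤ u v) (hmono : Monotone u) :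
    Monotone (weight δ u v₀) := by
  intro x y hxy
  by_cases hx : x ≤ v₀
  · simpa only [weight, if_pos hx] using one_le_weight hδ hu y
  · have hy : ¬y ≤ v₀ := fun hy => hx (hxy.trans hy)
    simp only [weight, if_neg hx, if_neg hy]
    gcongr
    exact hmono hxy

theorem weight_max_le {u : ℝ → ℝ} (hδ : 0 ≤ δ) {y : ℝ} (hy : 0 ≤ u y) :
    weight δ u v₀ (max v₀ y) ≤ 1 + δ * u y := by
  unfold weight
  split_ifs with hle
  · exact le_add_of_nonneg_right (mul_nonneg hδ hy)
  · rw [max_eq_right (le_of_lt <| by simpa using hle)]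

theorem weight_potential_le (hδ : 0 ≤ δ) (hε : 0 ≤ ε) (v : ℝ) :
    weight δ (potential ε B) v₀ v ≤ (1 + δ * (1 + ε)) * (1 + |v|) := by
  have hu : potential ε B v ≤ (1 + ε) * (1 + |v|) := by
    nlinarith [potential_le ε B v, abs_nonneg v, mul_le_mul_of_nonneg_left (le_abs_self v) hε]
  have hδu := mul_le_mul_of_nonneg_left hu hδ
  have h0 : 0 ≤ δ * ((1 + ε) * (1 + |v|)) := by positivity
  unfold weight
  split_ifs <;> nlinarith [abs_nonneg v]

/-- A weight function for the random recursion `v ↦ max v₀ (ρ v + e)`, where `e` is a standard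
exponential variable: its expectation decreases geometrically outside the bottom state `v₀`, and
the expected increase at `v₀` is compensated by a coupling of probability `exp (-L)`. -/
structure IsWeight (ρ v₀ L : ℝ) (w : ℝ → ℝ) (γ A : ℝ) : Prop where
  mono : Monotone w
  one_le : ∀ v, 1 ≤ w v
  le : ∀ v, w v ≤ A * (1 + |v|)
  drift : ∀ v > v₀, ∫ e, w (max v₀ (ρ * v + e)) ∂expMeasure 1 ≤ γ * w v
  bottom : (1 - Real.exp (-L)) * ∫ e, w (max v₀ (ρ * v₀ + e)) ∂expMeasure 1 ≤ γ * w v₀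

theorem integrable_max_add_of_monotone {w : ℝ → ℝ} {A : ℝ} (hw : Monotone w)
    (hle : ∀ v, |w v| ≤ A * (1 + |v|)) (v₀ c : ℝ) :
    Integrable (fun e => w (max v₀ (c + e))) (expMeasure 1) := by
  have hA : 0 ≤ A := by simpa using (abs_nonneg _).trans (hle 0)
  refine Integrable.mono' (g := fun e => A * (1 + |v₀| + |c| + |e|))
    (((integrable_const _).add (integrable_id_expMeasure one_pos).abs).const_mul A)
    (hw.measurable.comp (by fun_prop)).aestronglyMeasurable (.of_forall fun e => ?_)
  refine (hle _).trans (mul_le_mul_of_nonneg_left ?_ hA)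
  have hmax : max |v₀| |c + e| ≤ |v₀| + |c + e| :=
    max_le_add_of_nonneg (abs_nonneg _) (abs_nonneg _)
  linarith [abs_max_le_max_abs_abs (a := v₀) (b := c + e), abs_add_le c e]

theorem IsWeight.integrable {w : ℝ → ℝ} {γ A : ℝ} (hw : IsWeight ρ v₀ L w γ A) (c : ℝ) :
    Integrable (fun e => w (max v₀ (c + e))) (expMeasure 1) :=
  integrable_max_add_of_monotone hw.mono
    (fun v => (abs_of_nonneg (zero_le_one.trans (hw.one_le v))).trans_le (hw.le v)) v₀ c

theorem integral_weight_potential_le (hδ : 0 ≤ δ) (hε : 0 ≤ ε) (hB : 0 ≤ B) (hv₀ : 0 ≤ v₀)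
    {c : ℝ} (hc : 0 ≤ c) :
    ∫ e, weight δ (potential ε B) v₀ (max v₀ (c + e)) ∂expMeasure 1 ≤
      1 + δ * ∫ e, potential ε B (c + e) ∂expMeasure 1 := by
  have hu : ∀ v > v₀, 0 ≤ potential ε B v := fun v hv =>
    potential_nonneg hε hB (hv₀.trans hv.le)
  have hone := one_le_weight hδ hu
  have hint : Integrable (fun e => δ * potential ε B (c + e)) (expMeasure 1) :=
    (integrable_potential_add (by linarith) c).const_mul δ
  calc ∫ e, weight δ (potential ε B) v₀ (max v₀ (c + e)) ∂expMeasure 1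
      ≤ ∫ e, (1 + δ * potential ε B (c + e)) ∂expMeasure 1 := by
        refine integral_mono_ae (integrable_max_add_of_monotone
          (monotone_weight hδ hu (monotone_potential hε hB)) (A := 1 + δ * (1 + ε)) (fun v => ?_)
          v₀ c) ((integrable_const _).add hint) ?_
        · rw [abs_of_nonneg (zero_le_one.trans (hone v))]
          exact weight_potential_le hδ hε v
        · filter_upwards [ae_pos_expMeasure 1] with e he
          exact weight_max_le hδ (potential_nonneg hε hB (by positivity))
    _ = 1 + δ * ∫ e, potential ε B (c + e) ∂expMeasure 1 := by
        rw [integral_add (integrable_const _) hint, integral_const_mul, integral_const,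
          probReal_univ, one_smul]

theorem weight_potential_drift (hδ : 0 ≤ δ) (hε : 0 ≤ ε) (hB : 0 ≤ B) (hρ : 0 ≤ ρ) (hη : 0 ≤ η)
    (hv₀ : 0 ≤ v₀) {v : ℝ} (hv : v₀ < v)
    (hdrift : ∫ e, potential ε B (ρ * v + e) ∂expMeasure 1 ≤
      potential ε B v - η * (1 + ε * v)) :
    ∫ e, weight δ (potential ε B) v₀ (max v₀ (ρ * v + e)) ∂expMeasure 1 ≤
      (1 - δ * η / (1 + δ)) * weight δ (potential ε B) v₀ v := by
  have hv0 : 0 ≤ v := hv₀.trans hv.le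
  refine (integral_weight_potential_le hδ hε hB hv₀ (mul_nonneg hρ hv0)).trans ?_
  rw [weight, if_neg hv.not_ge]
  have hle : 1 + δ * potential ε B v ≤ (1 + ε * v) * (1 + δ) := by
    nlinarith [mul_le_mul_of_nonneg_left (potential_le ε B v) hδ, mul_nonneg hε hv0]
  have hdecr : δ * η / (1 + δ) * (1 + δ * potential ε B v) ≤ δ * (η * (1 + ε * v)) := by
    rw [div_mul_eq_mul_div, div_le_iff₀ (by positivity)]
    nlinarith [mul_le_mul_of_nonneg_left hle (mul_nonneg hδ hη)]
  linarith [mul_le_mul_of_nonneg_left hdrift hδ]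

theorem weight_potential_bottom (hδ : 0 ≤ δ) (hε : 0 ≤ ε) (hB : 0 ≤ B) (hρ : 0 ≤ ρ) (hv₀ : 0 ≤ v₀)
    (hL : 0 ≤ L) (hδL : δ * (1 + ε * (ρ * v₀ + 1)) ≤ Real.exp (-L) / 2) :
    (1 - Real.exp (-L)) * ∫ e, weight δ (potential ε B) v₀ (max v₀ (ρ * v₀ + e)) ∂expMeasure 1 ≤
      1 - Real.exp (-L) / 2 := by
  have hp : Real.exp (-L) ≤ 1 := by simpa using hL
  have hexp : 0 ≤ Real.exp (-(B * (ρ * v₀))) / (1 + B) := by positivity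
  have hint := integral_weight_potential_le hδ hε hB hv₀ (mul_nonneg hρ hv₀)
  rw [integral_potential_add (by linarith)] at hint
  have hle : ∫ e, weight δ (potential ε B) v₀ (max v₀ (ρ * v₀ + e)) ∂expMeasure 1 ≤
      1 + Real.exp (-L) / 2 := by
    nlinarith [mul_nonneg hδ hexp]
  nlinarith [mul_le_mul_of_nonneg_left hle (sub_nonneg.2 hp), sq_nonneg (Real.exp (-L))]

theorem exists_isWeight (hρ : 0 ≤ ρ) (hρ1 : ρ < 1) (hv₀ : 0 < v₀) (hL : 0 ≤ L) :
    ∃ (w : ℝ → ℝ) (γ A : ℝ), 0 < γ ∧ γ < 1 ∧ IsWeight ρ v₀ L w γ A := by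
  obtain ⟨B, hB, ε, hε, η, hη, hdrift⟩ := exists_potential_drift hρ hρ1 hv₀
  have hp : Real.exp (-L) ≤ 1 := by simpa using hL
  have hp0 := Real.exp_pos (-L)
  set C := 1 + ε * (ρ * v₀ + 1)
  have hC : 0 < C := by positivity
  set δ := Real.exp (-L) / 2 / C
  have hδ : 0 < δ := by positivity
  have hu : ∀ v > v₀, 0 ≤ potential ε B v := fun v hv =>
    potential_nonneg hε.le hB.le (hv₀.trans hv).le
  have hone := one_le_weight hδ.le hu
  have hrate : 0 < δ * η / (1 + δ) := by positivity
  refine ⟨weight δ (potential ε B) v₀, max (1 - δ * η / (1 + δ)) (1 - Real.exp (-L) / 2),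
    1 + δ * (1 + ε), lt_max_of_lt_right (by linarith), max_lt (by linarith) (by linarith),
    monotone_weight hδ.le hu (monotone_potential hε.le hB.le), hone,
    weight_potential_le hδ.le hε.le, fun v hv => ?_, ?_⟩
  · exact (weight_potential_drift hδ.le hε.le hB.le hρ hη.le hv₀.le hv (hdrift v hv.le)).trans
      (mul_le_mul_of_nonneg_right (le_max_left _ _) (zero_le_one.trans (hone v)))
  · rw [show weight δ (potential ε B) v₀ v₀ = 1 from if_pos le_rfl, mul_one]
    exact (weight_potential_bottom hδ.le hε.le hB.le hρ hv₀.le hL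
      (div_mul_cancel₀ _ hC.ne').le).trans (le_max_right _ _)

end Weights

section RandomRecursion

variable {E α : Type*}

/-- The sequence which follows `p.1` before time `n` and restarts with `p.2` at time `n`. -/
def splice (n : ℕ) (p : (ℕ → E) × (ℕ → E)) : ℕ → E :=
  fun i => if i < n then p.1 i else p.2 (i - n)

theorem splice_preimage_pi (n : ℕ) (s : Finset ℕ) (t : ℕ → Set E) :
    splice n ⁻¹' (s : Set ℕ).pi t =
      ((s.filter (· < n) : Finset ℕ) : Set ℕ).pi t ×ˢ
        ((s.preimage (n + ·) (add_right_injective n).injOn : Finset ℕ) : Set ℕ).pi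
          fun i => t (n + i) := by
  ext ⟨ω, ω'⟩
  simp only [mem_preimage, Set.mem_pi, mem_prod, Finset.mem_coe, splice, Finset.mem_filter,
    Finset.mem_preimage]
  refine ⟨fun H => ⟨fun i hi => by simpa [hi.2] using H i hi.1,
    fun i hi => by simpa using H (n + i) hi⟩, fun ⟨H₁, H₂⟩ i hi => ?_⟩
  split_ifs with hin
  · exact H₁ i ⟨hi, hin⟩
  · obtain ⟨j, rfl⟩ := Nat.exists_eq_add_of_le (not_lt.1 hin)
    simpa using H₂ j hi

/-- The random recursion `X₀ = x`, `X_{n+1} = F X_n ω_n`. -/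
def recursion (F : α → E → α) (x : α) : ℕ → (ℕ → E) → α
  | 0, _ => x
  | n + 1, ω => F (recursion F x n ω) (ω n)

theorem recursion_splice_of_le (F : α → E → α) (x : α) (n : ℕ) (p : (ℕ → E) × (ℕ → E)) {j : ℕ}
    (hj : j ≤ n) : recursion F x j (splice n p) = recursion F x j p.1 := by
  induction j with
  | zero => rfl
  | succ j ih => simp [recursion, ih (by omega), splice, show j < n by omega]

theorem recursion_splice_add (F : α → E → α) (x : α) (n : ℕ) (p : (ℕ → E) × (ℕ → E)) (j : ℕ) :
    recursion F x (n + j) (splice n p) = recursion F (recursion F x n p.1) j p.2 := by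
  induction j with
  | zero => exact recursion_splice_of_le F x n p le_rfl
  | succ j ih =>
    rw [← add_assoc]
    simp [recursion, ih, splice]

variable [MeasurableSpace E] {μ : Measure E} [IsProbabilityMeasure μ]

/-- The law of a sequence of independent variables of law `μ`. -/
noncomputable abbrev iid (μ : Measure E) [IsProbabilityMeasure μ] : Measure (ℕ → E) :=
  Measure.infinitePi fun _ => μ

theorem measurable_splice (n : ℕ) : Measurable (splice n : (ℕ → E) × (ℕ → E) → ℕ → E) := by
  refine measurable_pi_lambda _ fun i => ?_
  unfold splice
  split_ifs <;> fun_prop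

theorem measurePreserving_splice (n : ℕ) :
    MeasurePreserving (splice n) ((iid μ).prod (iid μ)) (iid μ) := by
  classical
  refine ⟨measurable_splice n, Measure.eq_infinitePi _ fun s t ht => ?_⟩
  have hrange : s.filter (fun i => ¬i < n) = s.filter (· ∈ Set.range (n + ·)) :=
    Finset.filter_congr fun i _ => by
      simpa [eq_comm] using (le_iff_exists_add (a := n) (b := i))
  rw [Measure.map_apply (measurable_splice n) (.pi s.countable_toSet fun i _ => ht i),
    splice_preimage_pi, Measure.prod_prod, Measure.infinitePi_pi _ fun i _ => ht i,
    Measure.infinitePi_pi _ fun i _ => ht (n + i),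
    Finset.prod_preimage' (n + ·) s _ fun i => μ (t i),
    ← Finset.prod_filter_mul_prod_filter_not s (· < n), hrange]

theorem measureReal_prod_eq_integral {α β : Type*} [MeasurableSpace α] [MeasurableSpace β]
    {P : Measure α} {Q : Measure β} [IsFiniteMeasure P] [IsFiniteMeasure Q] {S : Set (α × β)}
    (hS : MeasurableSet S) :
    (P.prod Q).real S = ∫ x, Q.real (Prod.mk x ⁻¹' S) ∂P := by
  simp only [measureReal_def]
  rw [Measure.prod_apply hS, integral_toReal (measurable_measure_prodMk_left hS).aemeasurable
    (.of_forall fun x => measure_lt_top _ _)]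

theorem measureReal_iid_eq_integral_splice (n : ℕ) {A : Set (ℕ → E)} (hA : MeasurableSet A) :
    (iid μ).real A = ∫ ω, (iid μ).real {ω' | splice n (ω, ω') ∈ A} ∂iid μ := by
  have h : (iid μ).real A = ((iid μ).prod (iid μ)).real (splice n ⁻¹' A) := by
    simp only [measureReal_def, (measurePreserving_splice n).measure_preimage hA.nullMeasurableSet]
  rw [h, measureReal_prod_eq_integral (measurable_splice n hA)]
  rfl

/-- The probability that the path of the random recursion started at `x` and shifted by `t` belongs
to `S`. -/
noncomputable def tailProb (F : α → E → α) (μ : Measure E) [IsProbabilityMeasure μ] (t : ℕ)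
    (S : Set (ℕ → α)) (x : α) : ℝ :=
  (iid μ).real {ω | (fun j => recursion F x (t + j) ω) ∈ S}

theorem tailProb_mem_Icc (F : α → E → α) (t : ℕ) (S : Set (ℕ → α)) (x : α) :
    tailProb F μ t S x ∈ Icc (0 : ℝ) 1 :=
  ⟨measureReal_nonneg, measureReal_le_one⟩

variable [MeasurableSpace α] {F : α → E → α}

theorem measurable_recursion_prod (hF : Measurable (Function.uncurry F)) (n : ℕ) :
    Measurable fun p : α × (ℕ → E) => recursion F p.1 n p.2 := by
  induction n with
  | zero => exact measurable_fst
  | succ n ih => exact hF.comp (ih.prodMk ((measurable_pi_apply n).comp measurable_snd))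

theorem measurable_recursion (hF : Measurable (Function.uncurry F)) (x : α) (n : ℕ) :
    Measurable (recursion F x n) :=
  (measurable_recursion_prod hF n).comp measurable_prodMk_left

theorem measurable_tailProb_section (hF : Measurable (Function.uncurry F)) (t : ℕ) {β : Type*}
    [MeasurableSpace β] {S : Set (β × (ℕ → α))} (hS : MeasurableSet S) :
    Measurable fun p : β × α => tailProb F μ t (Prod.mk p.1 ⁻¹' S) p.2 := by
  have hpath : Measurable fun q : (β × α) × (ℕ → E) =>
      (q.1.1, fun j => recursion F q.1.2 (t + j) q.2) :=
    (measurable_fst.comp measurable_fst).prodMk <| measurable_pi_lambda _ fun j =>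
      (measurable_recursion_prod hF (t + j)).comp
        ((measurable_snd.comp measurable_fst).prodMk measurable_snd)
  exact (measurable_measure_prodMk_left (hpath hS)).ennreal_toReal

theorem measurable_tailProb (hF : Measurable (Function.uncurry F)) (t : ℕ) {S : Set (ℕ → α)}
    (hS : MeasurableSet S) : Measurable (tailProb F μ t S) :=
  (measurable_tailProb_section hF t (β := Unit) (measurable_snd hS)).comp
    (measurable_prodMk_left (x := ()))

theorem measureReal_recursion_eq_integral_tailProb (hF : Measurable (Function.uncurry F))
    {β : Type*} [MeasurableSpace β] {S : Set (β × (ℕ → α))} (hS : MeasurableSet S) (x : α) (k t : ℕ)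
    {A : (ℕ → E) → β} (hA : Measurable A) (hpast : ∀ ω ω', A (splice k (ω, ω')) = A ω) :
    (iid μ).real {ω | (A ω, fun j => recursion F x (k + (t + j)) ω) ∈ S} =
      ∫ ω, tailProb F μ t (Prod.mk (A ω) ⁻¹' S) (recursion F x k ω) ∂iid μ := by
  have hpath : Measurable fun ω => (A ω, fun j => recursion F x (k + (t + j)) ω) :=
    hA.prodMk (measurable_pi_lambda _ fun j => measurable_recursion hF x _)
  refine (measureReal_iid_eq_integral_splice k (hpath hS)).trans ?_
  simp only [mem_preimage, hpast, recursion_splice_add]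
  rfl

theorem tailProb_succ (hF : Measurable (Function.uncurry F)) {S : Set (ℕ → α)}
    (hS : MeasurableSet S) (t : ℕ) (x : α) :
    tailProb F μ (t + 1) S x = ∫ e, tailProb F μ t S (F x e) ∂μ := by
  have hstep := measureReal_recursion_eq_integral_tailProb (μ := μ) hF
    (measurable_snd hS : MeasurableSet (Prod.snd ⁻¹' S)) x 1 t
    (A := fun _ => ()) measurable_const fun _ _ => rfl
  have heval := (measurePreserving_eval_infinitePi (fun _ : ℕ => μ) 0).map_eq
  calc tailProb F μ (t + 1) S x
      = ∫ ω, tailProb F μ t S (F x (ω 0)) ∂iid μ := by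
        simp only [tailProb, add_comm t 1, add_assoc]
        exact hstep
    _ = ∫ e, tailProb F μ t S (F x e) ∂μ := by
        have hmeas : Measurable fun e => tailProb F μ t S (F x e) :=
          (measurable_tailProb hF t hS).comp (hF.comp measurable_prodMk_left)
        have hmap := integral_map (μ := iid μ) (measurable_pi_apply 0).aemeasurable
          hmeas.aestronglyMeasurable
        rw [heval] at hmap
        exact hmap.symm

theorem integrable_and_integral_recursion_le (hF : Measurable (Function.uncurry F)) {V : α → ℝ}
    (hV : Measurable V) (hV0 : ∀ x, 0 ≤ V x) {ρ : ℝ} (hρ : 0 ≤ ρ) (hρ1 : ρ < 1) {ξ : E → ℝ}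
    (hξ : Integrable ξ μ) (hξ0 : 0 ≤ ∫ e, ξ e ∂μ)
    (hstep : ∀ᵐ e ∂μ, ∀ x, V (F x e) ≤ ρ * V x + ξ e) (x : α) (n : ℕ) :
    Integrable (fun ω => V (recursion F x n ω)) (iid μ) ∧
      ∫ ω, V (recursion F x n ω) ∂iid μ ≤ V x + (∫ e, ξ e ∂μ) / (1 - ρ) := by
  have hρ' : 0 < 1 - ρ := sub_pos.2 hρ1
  induction n with
  | zero =>
    simp only [recursion]
    refine ⟨integrable_const _, ?_⟩
    simpa using div_nonneg hξ0 hρ'.le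
  | succ n ih =>
    have heval := measurePreserving_eval_infinitePi (fun _ : ℕ => μ) n
    have hξn : Integrable (fun ω : ℕ → E => ξ (ω n)) (iid μ) :=
      heval.integrable_comp_of_integrable hξ
    have hξn_eq : ∫ ω : ℕ → E, ξ (ω n) ∂iid μ = ∫ e, ξ e ∂μ := by
      conv_rhs => rw [← heval.map_eq]
      refine (integral_map heval.aemeasurable ?_).symm
      rw [heval.map_eq]
      exact hξ.aestronglyMeasurable
    have hle : ∀ᵐ ω ∂iid μ, V (recursion F x (n + 1) ω) ≤ ρ * V (recursion F x n ω) + ξ (ω n) := by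
      filter_upwards [heval.quasiMeasurePreserving.ae hstep] with ω hω
      exact hω _
    have hbound := (ih.1.const_mul ρ).add hξn
    have hint : Integrable (fun ω => V (recursion F x (n + 1) ω)) (iid μ) := by
      refine hbound.mono' (hV.comp (measurable_recursion hF x _)).aestronglyMeasurable ?_
      filter_upwards [hle] with ω hω
      rwa [Real.norm_eq_abs, abs_of_nonneg (hV0 _)]
    refine ⟨hint, (integral_mono_ae hint hbound hle).trans ?_⟩
    simp only [Pi.add_apply]
    rw [integral_add (ih.1.const_mul ρ) hξn, integral_const_mul, hξn_eq]
    have hfix : (∫ e, ξ e ∂μ) / (1 - ρ) * (1 - ρ) = ∫ e, ξ e ∂μ := div_mul_cancel₀ _ hρ'.ne'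
    nlinarith [mul_le_mul_of_nonneg_left ih.2 hρ, mul_nonneg hρ'.le (hV0 x)]

end RandomRecursion

section BetaMixing

variable {Ω : Type*}

theorem sigmaBetween_zero_eq_comap (Z : ℕ → Ω → ℝ) (k : ℕ) :
    sigmaBetween Z 0 k = MeasurableSpace.comap (fun ω (j : Iic k) => Z j ω) MeasurableSpace.pi := by
  simp only [MeasurableSpace.pi, MeasurableSpace.comap_iSup, MeasurableSpace.comap_comp]
  refine Equiv.iSup_congr (Equiv.subtypeEquivRight fun j => ?_) fun j => rfl
  simp

theorem sigmaBetween_top_eq_comap (Z : ℕ → Ω → ℝ) (n : ℕ) :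
    sigmaBetween Z n ⊤ = MeasurableSpace.comap (fun ω j => Z (n + j) ω) MeasurableSpace.pi := by
  simp only [MeasurableSpace.pi, MeasurableSpace.comap_iSup, MeasurableSpace.comap_comp]
  refine le_antisymm (iSup_le fun j => ?_) (iSup_le fun j => ?_)
  · obtain ⟨i, hi⟩ := Nat.exists_eq_add_of_le j.2.1
    exact (congrArg (fun m => MeasurableSpace.comap (Z m) (borel ℝ)) hi).trans_le
      (le_iSup (fun i => MeasurableSpace.comap (Z (n + i)) (borel ℝ)) i)
  · exact le_iSup (fun j : {j : ℕ // n ≤ j ∧ (j : ℕ∞) ≤ ⊤} =>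
      MeasurableSpace.comap (Z j) (borel ℝ)) ⟨n + j, Nat.le_add_right n j, le_top⟩

variable [MeasurableSpace Ω] {P : Measure Ω}

theorem betaCoeff_eq_iSup (P : Measure Ω) (Z : ℕ → Ω → ℝ) (t : ℕ) :
    betaCoeff P Z t = ⨆ (k : ℕ) (S : Set ((Iic k → ℝ) × (ℕ → ℝ))) (_ : MeasurableSet S),
      ENNReal.ofReal |P.real {ω | (fun j : Iic k => Z j ω, fun j => Z (t + k + j) ω) ∈ S} -
        (P.prod P).real {p | (fun j : Iic k => Z j p.1, fun j => Z (t + k + j) p.2) ∈ S}| := by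
  refine iSup_congr fun k => ?_
  rw [sigmaBetween_zero_eq_comap, sigmaBetween_top_eq_comap, ← MeasurableSpace.comap_prodMap]
  refine le_antisymm (iSup₂_le fun E hE => ?_) (iSup₂_le fun S hS => ?_)
  · obtain ⟨S, hS, rfl⟩ := hE
    exact le_iSup₂_of_le S hS le_rfl
  · exact le_iSup₂_of_le _ ⟨S, hS, rfl⟩ le_rfl

theorem betaCoeff_congr_ae [SFinite P] {Z Z' : ℕ → Ω → ℝ} (hZ : ∀ᵐ ω ∂P, ∀ n, Z n ω = Z' n ω)
    (t : ℕ) : betaCoeff P Z t = betaCoeff P Z' t := by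
  simp only [betaCoeff_eq_iSup]
  refine iSup_congr fun k => iSup_congr fun S => iSup_congr fun _ => ?_
  congr 3
  · refine measureReal_congr (Filter.eventuallyEq_set.2 ?_)
    filter_upwards [hZ] with ω hω
    simp only [hω]
  · refine measureReal_congr (Filter.eventuallyEq_set.2 ?_)
    filter_upwards [Measure.quasiMeasurePreserving_fst.ae hZ,
      Measure.quasiMeasurePreserving_snd.ae hZ] with p h₁ h₂
    simp only [h₁, h₂]

theorem abs_integral_diag_sub_integral_prod_le [IsProbabilityMeasure P] {Ψ : Ω × Ω → ℝ}
    (hdiag : Integrable (fun ω => Ψ (ω, ω)) P) (hΨ : Integrable Ψ (P.prod P)) {V : Ω → ℝ}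
    (hV : Integrable V P) (hosc : ∀ ω ω', |Ψ (ω, ω) - Ψ (ω, ω')| ≤ V ω + V ω') :
    |∫ ω, Ψ (ω, ω) ∂P - ∫ p, Ψ p ∂P.prod P| ≤ 2 * ∫ ω, V ω ∂P := by
  have hfst : ∫ p : Ω × Ω, Ψ (p.1, p.1) ∂P.prod P = ∫ ω, Ψ (ω, ω) ∂P := by
    rw [integral_fun_fst (fun ω => Ψ (ω, ω)), probReal_univ, one_smul]
  calc |∫ ω, Ψ (ω, ω) ∂P - ∫ p, Ψ p ∂P.prod P|
      = |∫ p : Ω × Ω, (Ψ (p.1, p.1) - Ψ p) ∂P.prod P| := by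
        rw [integral_sub (hdiag.comp_fst P) hΨ, hfst]
    _ ≤ ∫ p : Ω × Ω, (V p.1 + V p.2) ∂P.prod P :=
        norm_integral_le_of_norm_le (f := fun p : Ω × Ω => Ψ (p.1, p.1) - Ψ p)
          ((hV.comp_fst P).add (hV.comp_snd P)) (.of_forall fun p => hosc p.1 p.2)
    _ = 2 * ∫ ω, V ω ∂P := by
        rw [integral_add (hV.comp_fst P) (hV.comp_snd P), integral_fun_fst, integral_fun_snd,
          probReal_univ, one_smul]
        ring

theorem betaCoeff_recursion_le {E : Type*} [MeasurableSpace E] {μ : Measure E}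
    [IsProbabilityMeasure μ] {F : ℝ → E → ℝ} (hF : Measurable (Function.uncurry F)) {V : ℝ → ℝ}
    {t : ℕ} (hosc : ∀ S, MeasurableSet S → ∀ x y,
      |tailProb F μ t S x - tailProb F μ t S y| ≤ V x + V y)
    {x c : ℝ} (hV : ∀ k, Integrable (fun ω => V (recursion F x k ω)) (iid μ))
    (hc : ∀ k, ∫ ω, V (recursion F x k ω) ∂iid μ ≤ c) :
    betaCoeff (iid μ) (recursion F x) t ≤ ENNReal.ofReal (2 * c) := by
  rw [betaCoeff_eq_iSup]
  refine iSup_le fun k => iSup₂_le fun S hS => ENNReal.ofReal_le_ofReal ?_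
  let past : (ℕ → E) → Iic k → ℝ := fun ω j => recursion F x j ω
  let future : (ℕ → E) → ℕ → ℝ := fun ω j => recursion F x (k + (t + j)) ω
  have hpast : Measurable past := measurable_pi_lambda _ fun j => measurable_recursion hF x j
  have hfuture : Measurable future := measurable_pi_lambda _ fun j => measurable_recursion hF x _
  have hsplice (ω ω') : past (splice k (ω, ω')) = past ω :=
    funext fun j => recursion_splice_of_le F x k (ω, ω') j.2
  let Ψ : (ℕ → E) × (ℕ → E) → ℝ := fun p =>
    tailProb F μ t (Prod.mk (past p.1) ⁻¹' S) (recursion F x k p.2)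
  have hΨ : Measurable Ψ := (measurable_tailProb_section hF t hS).comp
    ((hpast.comp measurable_fst).prodMk ((measurable_recursion hF x k).comp measurable_snd))
  have hjoint : (iid μ).real {ω | (past ω, future ω) ∈ S} = ∫ ω, Ψ (ω, ω) ∂iid μ :=
    measureReal_recursion_eq_integral_tailProb hF hS x k t hpast hsplice
  have hprod : ((iid μ).prod (iid μ)).real {p | (past p.1, future p.2) ∈ S} =
      ∫ p, Ψ p ∂(iid μ).prod (iid μ) := by
    rw [integral_prod _ (.of_mem_Icc 0 1 hΨ.aemeasurable
      (.of_forall fun _ => tailProb_mem_Icc F t _ _))]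
    refine (measureReal_prod_eq_integral ((hpast.prodMap hfuture) hS)).trans ?_
    exact integral_congr_ae (.of_forall fun ω => measureReal_recursion_eq_integral_tailProb hF hS
      x k t measurable_const fun _ _ => rfl)
  have hindex (j : ℕ) : t + k + j = k + (t + j) := by ring
  simp only [hindex]
  change |(iid μ).real {ω | (past ω, future ω) ∈ S} -
    ((iid μ).prod (iid μ)).real {p | (past p.1, future p.2) ∈ S}| ≤ 2 * c
  rw [hjoint, hprod]
  refine (abs_integral_diag_sub_integral_prod_le ?_ ?_ (hV k)
    fun ω ω' => hosc _ (measurable_prodMk_left hS) _ _).trans (by linarith [hc k])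
  · exact .of_mem_Icc 0 1 (hΨ.comp (measurable_id.prodMk measurable_id)).aemeasurable
      (.of_forall fun _ => tailProb_mem_Icc F t _ _)
  · exact .of_mem_Icc 0 1 hΨ.aemeasurable (.of_forall fun _ => tailProb_mem_Icc F t _ _)

end BetaMixing

section Contraction

variable {α : Type*} [MeasurableSpace α]

/-- The step `x ↦ q (h x + e)` of a random recursion driven by standard exponential variables `e`:
`h x` is the level of the state `x` and `q y` is the state reached at the level `y`. -/
def levelStep (h : α → ℝ) (q : ℝ → α) (x : α) (e : ℝ) : α := q (h x + e)

/-- A function `V` whose values along the recursion of step `levelStep h q` are dominated by those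
of the recursion `v ↦ max v₀ (ρ v + e)`, and whose bottom states `V x ≤ v₀` have levels at distance
at most `L` from each other. -/
structure IsLyapunov (h : α → ℝ) (q : ℝ → α) (V : α → ℝ) (ρ v₀ L : ℝ) : Prop where
  measurable_h : Measurable h
  measurable_q : Measurable q
  measurable_V : Measurable V
  le_V : ∀ x, v₀ ≤ V x
  V_step_le : ∀ x, ∀ e ≥ 0, V (levelStep h q x e) ≤ max v₀ (ρ * V x + e)
  level_mem : ∀ x, V x ≤ v₀ → h x ∈ Icc 0 L
  mono : Monotone fun c => V (q c)

variable {h : α → ℝ} {q : ℝ → α} {V : α → ℝ} {ρ v₀ L : ℝ}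

theorem IsLyapunov.measurable_step (hV : IsLyapunov h q V ρ v₀ L) :
    Measurable (Function.uncurry (levelStep h q)) :=
  hV.measurable_q.comp ((hV.measurable_h.comp measurable_fst).add measurable_snd)

theorem IsLyapunov.V_apply_le_of_le (hV : IsLyapunov h q V ρ v₀ L) (hv₀ : 0 ≤ v₀) (hρ1 : ρ ≤ 1)
    {y : α} (hy : V y ≤ v₀) {c : ℝ} (hc : c ≤ h y) : V (q c) ≤ v₀ := by
  have hstep := hV.V_step_le y 0 le_rfl
  simp only [levelStep, add_zero] at hstep
  exact (hV.mono hc).trans (hstep.trans (max_le le_rfl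
    ((mul_le_of_le_one_left (hv₀.trans (hV.le_V y)) hρ1).trans hy)))

variable {w : ℝ → ℝ} {γ A : ℝ} {G : α → ℝ} {C : ℝ}

theorem IsLyapunov.abs_sub_integral_le (hV : IsLyapunov h q V ρ v₀ L) (hρ : 0 ≤ ρ)
    (hw : IsWeight ρ v₀ L w γ A) (hG : ∀ x, Integrable (fun e => G (levelStep h q x e))
      (expMeasure 1)) (hC : 0 ≤ C) (hosc : ∀ x y, |G x - G y| ≤ C * w (max (V x) (V y)))
    {y z : α} (hy : V y ≤ v₀) (hz : V z ≤ v₀) :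
    |G z - ∫ e, G (levelStep h q y e) ∂expMeasure 1| ≤
      C * ∫ e, w (max v₀ (ρ * v₀ + e)) ∂expMeasure 1 := by
  have hsub : G z - ∫ e, G (levelStep h q y e) ∂expMeasure 1 =
      ∫ e, (G z - G (levelStep h q y e)) ∂expMeasure 1 := by
    rw [integral_sub (integrable_const _) (hG y), integral_const, probReal_univ, one_smul]
  rw [hsub, ← integral_const_mul, ← Real.norm_eq_abs]
  refine norm_integral_le_of_norm_le ((hw.integrable _).const_mul C) ?_
  filter_upwards [ae_pos_expMeasure 1] with e he
  refine (hosc _ _).trans (mul_le_mul_of_nonneg_left (hw.mono ?_) hC)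
  refine max_le (hz.trans (le_max_left _ _)) ((hV.V_step_le y e he.le).trans ?_)
  gcongr

theorem IsLyapunov.abs_integral_sub_le_of_level_le (hV : IsLyapunov h q V ρ v₀ L) (hv₀ : 0 ≤ v₀)
    (hρ : 0 ≤ ρ) (hρ1 : ρ ≤ 1) (hw : IsWeight ρ v₀ L w γ A)
    (hG : ∀ x, Integrable (fun e => G (levelStep h q x e)) (expMeasure 1)) (hC : 0 ≤ C)
    (hosc : ∀ x y, |G x - G y| ≤ C * w (max (V x) (V y))) {x y : α} (hx : V x ≤ v₀)
    (hy : V y ≤ v₀) (hxy : h x ≤ h y) :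
    |∫ e, G (levelStep h q x e) ∂expMeasure 1 - ∫ e, G (levelStep h q y e) ∂expMeasure 1| ≤
      C * (γ * w v₀) := by
  set W := ∫ e, w (max v₀ (ρ * v₀ + e)) ∂expMeasure 1
  have hW : 0 ≤ W := integral_nonneg fun e => zero_le_one.trans (hw.one_le _)
  have hshift (e : ℝ) : levelStep h q x (h y - h x + e) = levelStep h q y e :=
    congrArg q (by ring)
  have hcoupling := abs_integral_sub_integral_const_add_le one_pos (hG x) (sub_nonneg.2 hxy)
    (B := C * W) fun e he => by
      simp only [hshift]
      exact hV.abs_sub_integral_le hρ hw hG hC hosc hy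
        (hV.V_apply_le_of_le hv₀ hρ1 hy (by linarith))
  simp only [hshift, one_mul] at hcoupling
  have hgap : h y - h x ≤ L := by linarith [(hV.level_mem x hx).1, (hV.level_mem y hy).2]
  calc |∫ e, G (levelStep h q x e) ∂expMeasure 1 - ∫ e, G (levelStep h q y e) ∂expMeasure 1|
      ≤ (1 - Real.exp (-(h y - h x))) * (C * W) := hcoupling
    _ ≤ (1 - Real.exp (-L)) * (C * W) := by gcongr
    _ = C * ((1 - Real.exp (-L)) * W) := by ring
    _ ≤ C * (γ * w v₀) := mul_le_mul_of_nonneg_left hw.bottom hC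

theorem IsLyapunov.abs_integral_sub_le_of_lt (hV : IsLyapunov h q V ρ v₀ L) (hρ : 0 ≤ ρ)
    (hw : IsWeight ρ v₀ L w γ A) (hG : ∀ x, Integrable (fun e => G (levelStep h q x e))
      (expMeasure 1)) (hC : 0 ≤ C) (hosc : ∀ x y, |G x - G y| ≤ C * w (max (V x) (V y)))
    {x y : α} (hxy : v₀ < max (V x) (V y)) :
    |∫ e, G (levelStep h q x e) ∂expMeasure 1 - ∫ e, G (levelStep h q y e) ∂expMeasure 1| ≤
      C * (γ * w (max (V x) (V y))) := by
  rw [← integral_sub (hG x) (hG y), ← Real.norm_eq_abs]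
  calc ‖∫ e, (G (levelStep h q x e) - G (levelStep h q y e)) ∂expMeasure 1‖
      ≤ ∫ e, C * w (max v₀ (ρ * max (V x) (V y) + e)) ∂expMeasure 1 := by
        refine norm_integral_le_of_norm_le ((hw.integrable _).const_mul C) ?_
        filter_upwards [ae_pos_expMeasure 1] with e he
        refine (hosc _ _).trans (mul_le_mul_of_nonneg_left (hw.mono (max_le ?_ ?_)) hC)
        · refine (hV.V_step_le x e he.le).trans ?_
          gcongr
          exact le_max_left _ _
        · refine (hV.V_step_le y e he.le).trans ?_
          gcongr
          exact le_max_right _ _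
    _ = C * ∫ e, w (max v₀ (ρ * max (V x) (V y) + e)) ∂expMeasure 1 := integral_const_mul _ _
    _ ≤ C * (γ * w (max (V x) (V y))) := mul_le_mul_of_nonneg_left (hw.drift _ hxy) hC

theorem IsLyapunov.abs_integral_sub_le (hV : IsLyapunov h q V ρ v₀ L) (hv₀ : 0 ≤ v₀)
    (hρ : 0 ≤ ρ) (hρ1 : ρ ≤ 1) (hw : IsWeight ρ v₀ L w γ A)
    (hG : ∀ x, Integrable (fun e => G (levelStep h q x e)) (expMeasure 1)) (hC : 0 ≤ C)
    (hosc : ∀ x y, |G x - G y| ≤ C * w (max (V x) (V y))) (x y : α) :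
    |∫ e, G (levelStep h q x e) ∂expMeasure 1 - ∫ e, G (levelStep h q y e) ∂expMeasure 1| ≤
      C * (γ * w (max (V x) (V y))) := by
  rcases le_or_gt (max (V x) (V y)) v₀ with hle | hlt
  · obtain ⟨hx, hy⟩ := max_le_iff.1 hle
    rw [le_antisymm hle ((hV.le_V x).trans (le_max_left _ _))]
    rcases le_total (h x) (h y) with hxy | hxy
    · exact hV.abs_integral_sub_le_of_level_le hv₀ hρ hρ1 hw hG hC hosc hx hy hxy
    · rw [abs_sub_comm]
      exact hV.abs_integral_sub_le_of_level_le hv₀ hρ hρ1 hw hG hC hosc hy hx hxy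
  · exact hV.abs_integral_sub_le_of_lt hρ hw hG hC hosc hlt

theorem IsLyapunov.abs_tailProb_sub_le (hV : IsLyapunov h q V ρ v₀ L) (hv₀ : 0 ≤ v₀)
    (hρ : 0 ≤ ρ) (hρ1 : ρ ≤ 1) (hw : IsWeight ρ v₀ L w γ A) (hγ : 0 ≤ γ) {S : Set (ℕ → α)}
    (hS : MeasurableSet S) (t : ℕ) (x y : α) :
    |tailProb (levelStep h q) (expMeasure 1) t S x -
      tailProb (levelStep h q) (expMeasure 1) t S y| ≤ γ ^ t * w (max (V x) (V y)) := by
  have hF := hV.measurable_step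
  induction t generalizing x y with
  | zero =>
    obtain ⟨hx0, hx1⟩ := tailProb_mem_Icc (μ := expMeasure 1) (levelStep h q) 0 S x
    obtain ⟨hy0, hy1⟩ := tailProb_mem_Icc (μ := expMeasure 1) (levelStep h q) 0 S y
    rw [pow_zero, one_mul]
    exact (abs_le.2 ⟨by linarith, by linarith⟩).trans (hw.one_le _)
  | succ t ih =>
    rw [tailProb_succ hF hS, tailProb_succ hF hS, pow_succ, mul_assoc]
    refine hV.abs_integral_sub_le hv₀ hρ hρ1 hw (fun z => ?_) (pow_nonneg hγ t) ih x y
    exact .of_mem_Icc 0 1 ((measurable_tailProb hF t hS).comp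
      (hF.comp measurable_prodMk_left)).aemeasurable (.of_forall fun _ => tailProb_mem_Icc _ t S _)

theorem IsLyapunov.integrable_and_integral_le (hV : IsLyapunov h q V ρ v₀ L) (hv₀ : 0 ≤ v₀)
    (hρ : 0 ≤ ρ) (hρ1 : ρ < 1) (x : α) (n : ℕ) :
    Integrable (fun ω => V (recursion (levelStep h q) x n ω)) (iid (expMeasure 1)) ∧
      ∫ ω, V (recursion (levelStep h q) x n ω) ∂iid (expMeasure 1) ≤
        V x + (v₀ + 1) / (1 - ρ) := by
  have hV0 (x : α) : 0 ≤ V x := hv₀.trans (hV.le_V x)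
  have hid := integrable_id_expMeasure one_pos
  have hmean : ∫ e, (v₀ + e) ∂expMeasure 1 = v₀ + 1 := by
    rw [integral_add (integrable_const _) hid, integral_id_expMeasure one_pos, integral_const,
      probReal_univ, one_smul, inv_one]
  have hξ : Integrable (fun e => v₀ + e) (expMeasure 1) := (integrable_const _).add hid
  rw [← hmean]
  refine integrable_and_integral_recursion_le hV.measurable_step hV.measurable_V hV0 hρ hρ1
    hξ (by rw [hmean]; positivity) ?_ x n
  filter_upwards [ae_pos_expMeasure 1] with e he y
  have := mul_nonneg hρ (hV0 y)
  exact (hV.V_step_le y e he.le).trans (max_le (by linarith) (by linarith))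

theorem IsLyapunov.integrable_and_integral_weight_le (hV : IsLyapunov h q V ρ v₀ L) (hv₀ : 0 ≤ v₀)
    (hρ : 0 ≤ ρ) (hρ1 : ρ < 1) (hw : IsWeight ρ v₀ L w γ A) (x : α) (n : ℕ) :
    Integrable (fun ω => w (V (recursion (levelStep h q) x n ω))) (iid (expMeasure 1)) ∧
      ∫ ω, w (V (recursion (levelStep h q) x n ω)) ∂iid (expMeasure 1) ≤
        A * (1 + (V x + (v₀ + 1) / (1 - ρ))) := by
  have hA : 0 ≤ A := by simpa using (zero_le_one.trans (hw.one_le 0)).trans (hw.le 0)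
  obtain ⟨hint, hle⟩ := hV.integrable_and_integral_le hv₀ hρ hρ1 x n
  have hwV (y : α) : w (V y) ≤ A * (1 + V y) := by
    simpa only [abs_of_nonneg (hv₀.trans (hV.le_V y))] using hw.le (V y)
  have hbound : Integrable (fun ω => A * (1 + V (recursion (levelStep h q) x n ω)))
      (iid (expMeasure 1)) := ((integrable_const _).add hint).const_mul A
  have hintw : Integrable (fun ω => w (V (recursion (levelStep h q) x n ω)))
      (iid (expMeasure 1)) := by
    refine hbound.mono' (hw.mono.measurable.comp (hV.measurable_V.comp
      (measurable_recursion hV.measurable_step x n))).aestronglyMeasurable (.of_forall fun ω => ?_)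
    rw [Real.norm_eq_abs, abs_of_nonneg (zero_le_one.trans (hw.one_le _))]
    exact hwV _
  refine ⟨hintw, (integral_mono hintw hbound fun ω => hwV _).trans ?_⟩
  rw [integral_const_mul, integral_add (integrable_const _) hint, integral_const, probReal_univ,
    one_smul]
  gcongr

theorem IsLyapunov.betaCoeff_le {h q V : ℝ → ℝ} (hV : IsLyapunov h q V ρ v₀ L) (hv₀ : 0 ≤ v₀)
    (hρ : 0 ≤ ρ) (hρ1 : ρ < 1) (hw : IsWeight ρ v₀ L w γ A) (hγ : 0 ≤ γ) (x : ℝ) (t : ℕ) :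
    betaCoeff (iid (expMeasure 1)) (recursion (levelStep h q) x) t ≤
      ENNReal.ofReal (2 * (A * (1 + (V x + (v₀ + 1) / (1 - ρ)))) * γ ^ t) := by
  have hmoment := hV.integrable_and_integral_weight_le hv₀ hρ hρ1 hw x
  rw [mul_assoc, mul_comm _ (γ ^ t)]
  refine betaCoeff_recursion_le (V := fun x => γ ^ t * w (V x)) hV.measurable_step
    (fun S hS x y => ?_) (fun k => (hmoment k).1.const_mul _) fun k => ?_
  · refine (hV.abs_tailProb_sub_le hv₀ hρ hρ1.le hw hγ hS t x y).trans ?_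
    rw [← mul_add, hw.mono.map_max]
    gcongr
    exact max_le_add_of_nonneg (zero_le_one.trans (hw.one_le _)) (zero_le_one.trans (hw.one_le _))
  · rw [integral_const_mul]
    exact mul_le_mul_of_nonneg_left (hmoment k).2 (pow_nonneg hγ t)

end Contraction

section Flow

variable {φ : ℝ → ℝ → ℝ} {f m M : ℝ → ℝ} {κ : ℝ}

theorem inv_apply {h : ℝ → ℝ} (hh : InjOn h (Ici 0)) {x : ℝ} (hx : 0 ≤ x) : inv h (h x) = x :=
  hh.leftInvOn_invFunOn hx

theorem apply_inv {h : ℝ → ℝ} {t : Set ℝ} (hh : SurjOn h (Ici 0) t) {y : ℝ} (hy : y ∈ t) :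
    h (inv h y) = y :=
  Function.invFunOn_eq (hh hy)

theorem inv_nonneg {h : ℝ → ℝ} {t : Set ℝ} (hh : SurjOn h (Ici 0) t) {y : ℝ} (hy : y ∈ t) :
    0 ≤ inv h y :=
  Function.invFunOn_mem (hh hy)

theorem injOn_inv {h : ℝ → ℝ} {t : Set ℝ} (hh : SurjOn h (Ici 0) t) : InjOn (inv h) t :=
  LeftInvOn.injOn fun _ hy => apply_inv hh hy

theorem image_inv_Icc {h : ℝ → ℝ} (hmono : StrictMonoOn h (Ici 0))
    (hsurj : SurjOn h (Ici 0) (Ici (h 0))) {t : ℝ} (ht : 0 ≤ t) :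
    inv h '' Icc (h 0) (h t) = Icc 0 t := by
  ext s
  constructor
  · rintro ⟨u, hu, rfl⟩
    have hnonneg : 0 ≤ inv h u := inv_nonneg hsurj hu.1
    exact ⟨hnonneg, (hmono.le_iff_le hnonneg ht).1 ((apply_inv hsurj hu.1).le.trans hu.2)⟩
  · intro hs
    exact ⟨h s, ⟨(hmono.le_iff_le self_mem_Ici hs.1).2 hs.1, (hmono.le_iff_le hs.1 ht).2 hs.2⟩,
      inv_apply hmono.injOn hs.1⟩

theorem IsConstrained.g_pos (hcon : IsConstrained φ f m M κ) {x y : ℝ} (hx : 0 < x)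
    (hy : f x ≤ y) : 0 < g φ f x y :=
  (hcon.m_pos y ((hcon.jump_pos x hx).trans_le hy)).trans_le (hcon.m_le_g x hx y hy)

theorem IsConstrained.hasDerivWithinAt_inv (hcon : IsConstrained φ f m M κ) {x y : ℝ} (hx : 0 < x)
    (hy : f x ≤ y) :
    HasDerivWithinAt (inv fun t => f (φ x t)) (g φ f x y) (Ici (f x)) y := by
  refine DifferentiableWithinAt.hasDerivWithinAt ?_
  by_contra hnd
  exact (hcon.g_pos hx hy).ne' (derivWithin_zero_of_not_differentiableWithinAt hnd)

/-- The positions from which the flow is positive at positive times: all positions, except the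
origin if it is a rest point. -/
def IsActive (φ : ℝ → ℝ → ℝ) (x : ℝ) : Prop := 0 ≤ x ∧ ∀ t > 0, 0 < φ x t

namespace IsCharacteristics

theorem jump_nonneg (H : IsCharacteristics φ f) {x : ℝ} (hx : 0 ≤ x) : 0 ≤ f x :=
  H.jump_diffeo.bijOn.mapsTo hx

theorem jump_zero (H : IsCharacteristics φ f) : f 0 = 0 := by
  obtain ⟨x, hx, hfx⟩ := H.jump_diffeo.bijOn.surjOn self_mem_Ici
  exact le_antisymm (hfx ▸ H.jump_strictMonoOn.monotoneOn self_mem_Ici hx hx)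
    (H.jump_nonneg le_rfl)

theorem jump_le_jump_iff (H : IsCharacteristics φ f) {x y : ℝ} (hx : 0 ≤ x) (hy : 0 ≤ y) :
    f x ≤ f y ↔ x ≤ y :=
  H.jump_strictMonoOn.le_iff_le hx hy

theorem continuousOn_jump (H : IsCharacteristics φ f) : ContinuousOn f (Ici 0) :=
  H.jump_diffeo.contDiffOn.continuousOn

theorem flow_zero (H : IsCharacteristics φ f) {x : ℝ} (hx : 0 ≤ x) : φ x 0 = x := by
  have hidem : φ x 0 = φ (φ x 0) 0 := by
    simpa only [add_zero] using H.flow_add x hx 0 le_rfl 0 le_rfl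
  have hinj := (H.flow_isEmbedding 0 le_rfl).injective
    (a₁ := ⟨x, hx⟩) (a₂ := ⟨φ x 0, H.flow_nonneg x hx 0 le_rfl⟩) hidem
  exact (congrArg Subtype.val hinj).symm

theorem continuousOn_flow (H : IsCharacteristics φ f) {x : ℝ} (hx : 0 ≤ x) :
    ContinuousOn (φ x) (Ici 0) :=
  H.flow_contDiffOn.continuousOn.comp (f := fun t : ℝ => (x, t)) (by fun_prop)
    fun _ ht => ⟨hx, ht⟩

theorem flow_sub (H : IsCharacteristics φ f) {x s t : ℝ} (hx : 0 ≤ x) (hs : 0 ≤ s) (hst : s ≤ t) :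
    φ (φ x s) (t - s) = φ x t := by
  rw [← H.flow_add x hx s hs (t - s) (sub_nonneg.2 hst), sub_add_cancel]

theorem lt_flow (H : IsCharacteristics φ f) {x t : ℝ} (hx : 0 < x) (ht : 0 < t) : x < φ x t := by
  refine lt_of_le_of_ne ((H.flow_diffeo x hx).bijOn.mapsTo ht.le) fun hfix => ?_
  refine ht.ne ((H.flow_diffeo x hx).bijOn.injOn self_mem_Ici ht.le ?_)
  rwa [H.flow_zero hx.le]

theorem isActive_of_pos (H : IsCharacteristics φ f) {x : ℝ} (hx : 0 < x) : IsActive φ x :=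
  ⟨hx.le, fun _ ht => hx.trans (H.lt_flow hx ht)⟩

theorem isActive_zero_or (H : IsCharacteristics φ f) :
    IsActive φ 0 ∨ ∀ t ≥ 0, φ 0 t = 0 := by
  by_contra! hcon
  obtain ⟨hnot, t, ht, hφt⟩ := hcon
  have hpos : 0 < φ 0 t := lt_of_le_of_ne (H.flow_nonneg 0 le_rfl t ht) hφt.symm
  refine hnot ⟨le_rfl, fun s hs => lt_of_le_of_ne (H.flow_nonneg 0 le_rfl s hs.le) fun hzero => ?_⟩
  have hfix : φ 0 t = φ (φ 0 t) s := by
    rw [← H.flow_add 0 le_rfl t ht s hs.le, add_comm, H.flow_add 0 le_rfl s hs.le t ht, ← hzero]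
  exact (H.lt_flow hpos hs).ne hfix

theorem flow_strictMonoOn (H : IsCharacteristics φ f) {x : ℝ} (hx : IsActive φ x) :
    StrictMonoOn (φ x) (Ici 0) := by
  intro s hs t _ hst
  rcases (mem_Ici.1 hs).eq_or_lt with rfl | hs0
  · rw [H.flow_zero hx.1]
    rcases hx.1.eq_or_lt with rfl | hx0
    · exact hx.2 t hst
    · exact H.lt_flow hx0 hst
  · rw [← H.flow_sub hx.1 hs hst.le]
    exact H.lt_flow (hx.2 s hs0) (sub_pos.2 hst)

theorem exists_flow_eq (H : IsCharacteristics φ f) {x : ℝ} (hx : IsActive φ x) {y : ℝ}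
    (hy : x ≤ y) : ∃ t ≥ 0, φ x t = y := by
  rcases le_total (φ x 1) y with hle | hle
  · obtain ⟨t, ht : 0 ≤ t, hty⟩ := (H.flow_diffeo _ (hx.2 1 one_pos)).bijOn.surjOn hle
    exact ⟨t + 1, by linarith, by rw [H.flow_add x hx.1 1 zero_le_one t ht, hty]⟩
  · obtain ⟨t, ht, hty⟩ := intermediate_value_Icc zero_le_one
      ((H.continuousOn_flow hx.1).mono Icc_subset_Ici_self)
      ⟨(H.flow_zero hx.1).trans_le hy, hle⟩
    exact ⟨t, ht.1, hty⟩

theorem strictMonoOn_jump_flow (H : IsCharacteristics φ f) {x : ℝ} (hx : IsActive φ x) :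
    StrictMonoOn (fun t => f (φ x t)) (Ici 0) :=
  H.jump_strictMonoOn.comp (H.flow_strictMonoOn hx) fun t ht => H.flow_nonneg x hx.1 t ht

theorem exists_jump_flow_eq (H : IsCharacteristics φ f) {x : ℝ} (hx : IsActive φ x) {u : ℝ}
    (hu : f x ≤ u) : ∃ t ≥ 0, f (φ x t) = u := by
  obtain ⟨y, hy, rfl⟩ := H.jump_diffeo.bijOn.surjOn ((H.jump_nonneg hx.1).trans hu)
  obtain ⟨t, ht, rfl⟩ := H.exists_flow_eq hx ((H.jump_le_jump_iff hx.1 hy).1 hu)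
  exact ⟨t, ht, rfl⟩

theorem inv_jump_eq_flow_inv (H : IsCharacteristics φ f) {x u : ℝ} (hx : IsActive φ x)
    (hu : f x ≤ u) : inv f u = φ x (inv (fun t => f (φ x t)) u) := by
  obtain ⟨t, ht, rfl⟩ := H.exists_jump_flow_eq hx hu
  rw [inv_apply (h := fun t => f (φ x t)) (H.strictMonoOn_jump_flow hx).injOn ht,
    inv_apply H.jump_strictMonoOn.injOn (H.flow_nonneg x hx.1 t ht)]

theorem inv_jump_flow_flow (H : IsCharacteristics φ f) {x s u : ℝ} (hx : 0 < x) (hs : 0 ≤ s)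
    (hu : f (φ x s) ≤ u) :
    inv (fun t => f (φ (φ x s) t)) u = inv (fun t => f (φ x t)) u - s := by
  have hxs : 0 < φ x s := hx.trans_le ((H.flow_diffeo x hx).bijOn.mapsTo hs)
  obtain ⟨t, ht, rfl⟩ := H.exists_jump_flow_eq (H.isActive_of_pos hxs) hu
  rw [inv_apply (h := fun t => f (φ (φ x s) t))
    (H.strictMonoOn_jump_flow (H.isActive_of_pos hxs)).injOn ht, ← H.flow_add x hx.le s hs t ht,
    inv_apply (h := fun t => f (φ x t)) (H.strictMonoOn_jump_flow (H.isActive_of_pos hx)).injOn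
      (add_nonneg ht hs), add_sub_cancel_right]

theorem g_flow (H : IsCharacteristics φ f) (hcon : IsConstrained φ f m M κ) {x s y : ℝ}
    (hx : 0 < x) (hs : 0 ≤ s) (hy : f (φ x s) ≤ y) : g φ f (φ x s) y = g φ f x y := by
  have hxs : f x ≤ f (φ x s) := (H.jump_le_jump_iff hx.le (H.flow_nonneg x hx.le s hs)).2
    ((H.flow_diffeo x hx).bijOn.mapsTo hs)
  have hderiv := ((hcon.hasDerivWithinAt_inv hx (hxs.trans hy)).mono
    (Ici_subset_Ici.2 hxs)).sub_const s
  exact (hderiv.congr_of_mem (fun u hu => H.inv_jump_flow_flow hx hs hu) hy).derivWithin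
    (uniqueDiffOn_Ici _ y hy)

theorem g_inv_eq (H : IsCharacteristics φ f) (hcon : IsConstrained φ f m M κ) {x y : ℝ}
    (hx : 0 < x) (hy : f x ≤ y) : g φ f (inv f y) y = g φ f x y := by
  obtain ⟨s, hs, rfl⟩ := H.exists_jump_flow_eq (H.isActive_of_pos hx) hy
  rw [inv_apply H.jump_strictMonoOn.injOn (H.flow_nonneg x hx.le s hs)]
  exact H.g_flow hcon hx hs le_rfl

end IsCharacteristics

end Flow

section CumRate

variable {φ : ℝ → ℝ → ℝ} {f m M lam : ℝ → ℝ} {κ : ℝ}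

namespace IsCharacteristics

theorem continuousOn_rate_flow (H : IsCharacteristics φ f) (hlam : ContinuousOn lam (Ici 0))
    {x : ℝ} (hx : 0 ≤ x) : ContinuousOn (fun s => lam (φ x s)) (Ici 0) :=
  hlam.comp (H.continuousOn_flow hx) fun s hs => H.flow_nonneg x hx s hs

theorem intervalIntegrable_rate_flow (H : IsCharacteristics φ f)
    (hlam : ContinuousOn lam (Ici 0)) {x s t : ℝ} (hx : 0 ≤ x) (hs : 0 ≤ s) (ht : 0 ≤ t) :
    IntervalIntegrable (fun u => lam (φ x u)) volume s t :=
  ((H.continuousOn_rate_flow hlam hx).mono fun _ hu =>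
    (le_min hs ht).trans hu.1).intervalIntegrable

theorem cumRate_add (H : IsCharacteristics φ f) (hlam : ContinuousOn lam (Ici 0)) {x s t : ℝ}
    (hx : 0 ≤ x) (hs : 0 ≤ s) (ht : 0 ≤ t) :
    cumRate φ lam x (t + s) = cumRate φ lam x s + cumRate φ lam (φ x s) t := by
  have hshift : cumRate φ lam (φ x s) t = ∫ u in s..t + s, lam (φ x u) := by
    have hcomp := intervalIntegral.integral_comp_add_right (fun u => lam (φ x u)) s
      (a := 0) (b := t)
    rw [zero_add] at hcomp
    rw [cumRate, ← hcomp]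
    refine intervalIntegral.integral_congr fun u hu => ?_
    rw [uIcc_of_le ht] at hu
    simp only [H.flow_add x hx s hs u hu.1]
  rw [hshift]
  exact (intervalIntegral.integral_add_adjacent_intervals
    (H.intervalIntegrable_rate_flow hlam hx le_rfl hs)
    (H.intervalIntegrable_rate_flow hlam hx hs (add_nonneg ht hs))).symm

theorem continuousOn_cumRate (H : IsCharacteristics φ f) (hlam : ContinuousOn lam (Ici 0))
    {x t : ℝ} (hx : 0 ≤ x) (ht : 0 ≤ t) : ContinuousOn (cumRate φ lam x) (Icc 0 t) := by
  have hint : IntegrableOn (fun s => lam (φ x s)) (uIcc 0 t) := by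
    rw [uIcc_of_le ht]
    exact ((H.continuousOn_rate_flow hlam hx).mono Icc_subset_Ici_self).integrableOn_Icc
  have hprim := intervalIntegral.continuousOn_primitive_interval hint
  rwa [uIcc_of_le ht] at hprim

end IsCharacteristics

/-- The jump rate read in the position `u` after the jump: along every trajectory it is the density
of the cumulated jump rate with respect to `u = f (φ x t)`. -/
noncomputable def hazardRate (φ : ℝ → ℝ → ℝ) (f lam : ℝ → ℝ) : ℝ → ℝ :=
  (Ioi 0).indicator fun u => g φ f (inv f u) u * lam (inv f u)

namespace IsCharacteristics

theorem abs_g_smul_rate_eq_hazardRate (H : IsCharacteristics φ f)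
    (hcon : IsConstrained φ f m M κ) {x u : ℝ} (hx : 0 < x) (hu : f x ≤ u) :
    |g φ f x u| • lam (φ x (inv (fun t => f (φ x t)) u)) = hazardRate φ f lam u := by
  rw [hazardRate, indicator_of_mem (mem_Ioi.2 ((hcon.jump_pos x hx).trans_le hu)),
    abs_of_pos (hcon.g_pos hx hu), H.g_inv_eq hcon hx hu,
    ← H.inv_jump_eq_flow_inv (H.isActive_of_pos hx) hu, smul_eq_mul]

theorem image_inv_jump_flow_Icc (H : IsCharacteristics φ f) {x t : ℝ} (hx : 0 < x) (ht : 0 ≤ t) :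
    inv (fun t => f (φ x t)) '' Icc (f x) (f (φ x t)) = Icc 0 t := by
  have hact := H.isActive_of_pos hx
  have hsurj : SurjOn (fun t => f (φ x t)) (Ici 0) (Ici (f (φ x 0))) := fun u hu => by
    rw [H.flow_zero hx.le] at hu
    exact H.exists_jump_flow_eq hact hu
  simpa only [H.flow_zero hx.le] using image_inv_Icc (H.strictMonoOn_jump_flow hact) hsurj ht

theorem integrableOn_hazardRate_and_cumRate_eq (H : IsCharacteristics φ f)
    (hcon : IsConstrained φ f m M κ) (hlam : ContinuousOn lam (Ici 0)) {x t : ℝ} (hx : 0 < x)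
    (ht : 0 ≤ t) :
    IntegrableOn (hazardRate φ f lam) (Icc (f x) (f (φ x t))) ∧
      cumRate φ lam x t = ∫ u in Icc (f x) (f (φ x t)), hazardRate φ f lam u := by
  have hderiv : ∀ u ∈ Icc (f x) (f (φ x t)),
      HasDerivWithinAt (inv fun t => f (φ x t)) (g φ f x u) (Icc (f x) (f (φ x t))) u := fun u hu =>
    (hcon.hasDerivWithinAt_inv hx hu.1).mono Icc_subset_Ici_self
  have hinj : InjOn (inv fun t => f (φ x t)) (Icc (f x) (f (φ x t))) :=
    injOn_inv fun u hu => H.exists_jump_flow_eq (H.isActive_of_pos hx) hu.1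
  have hcongr : EqOn (fun u => |g φ f x u| • lam (φ x (inv (fun t => f (φ x t)) u)))
      (hazardRate φ f lam) (Icc (f x) (f (φ x t))) :=
    fun u hu => H.abs_g_smul_rate_eq_hazardRate hcon hx hu.1
  constructor
  · refine IntegrableOn.congr_fun ?_ hcongr measurableSet_Icc
    rw [← integrableOn_image_iff_integrableOn_abs_deriv_smul measurableSet_Icc hderiv hinj
      (fun s => lam (φ x s)), H.image_inv_jump_flow_Icc hx ht]
    exact ((H.continuousOn_rate_flow hlam hx.le).mono Icc_subset_Ici_self).integrableOn_Icc
  · rw [← setIntegral_congr_fun measurableSet_Icc hcongr,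
      ← integral_image_eq_integral_abs_deriv_smul measurableSet_Icc hderiv hinj
      (fun s => lam (φ x s)), H.image_inv_jump_flow_Icc hx ht, cumRate,
      intervalIntegral.integral_of_le ht, integral_Icc_eq_integral_Ioc]

theorem cumRate_eq_of_forall_pos (H : IsCharacteristics φ f) (hlam : ContinuousOn lam (Ici 0))
    {C : ℝ → ℝ} (hC : Continuous C)
    (hpos : ∀ x > 0, ∀ t ≥ 0, cumRate φ lam x t = C (f (φ x t)) - C (f x)) {x : ℝ}
    (hx : IsActive φ x) {t : ℝ} (ht : 0 ≤ t) :
    cumRate φ lam x t = C (f (φ x t)) - C (f x) := by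
  rcases ht.eq_or_lt with rfl | ht0
  · rw [H.flow_zero hx.1, sub_self, cumRate, intervalIntegral.integral_same]
  have hconst : EqOn (fun s => cumRate φ lam x s - C (f (φ x s)))
      (fun _ => cumRate φ lam x t - C (f (φ x t))) (Ioc 0 t) := fun s hs => by
    have hadd := H.cumRate_add hlam hx.1 hs.1.le (sub_nonneg.2 hs.2)
    rw [sub_add_cancel, hpos (φ x s) (hx.2 s hs.1) (t - s) (sub_nonneg.2 hs.2),
      H.flow_sub hx.1 hs.1.le hs.2] at hadd
    simp only
    linarith
  have hcont : ContinuousOn (fun s => cumRate φ lam x s - C (f (φ x s))) (Icc 0 t) :=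
    (H.continuousOn_cumRate hlam hx.1 ht).sub (hC.comp_continuousOn (H.continuousOn_jump.comp
      ((H.continuousOn_flow hx.1).mono Icc_subset_Ici_self) fun s hs =>
        H.flow_nonneg x hx.1 s hs.1))
  have hzero := hconst.of_subset_closure hcont continuousOn_const Ioc_subset_Icc_self
    (closure_Ioc ht0.ne).ge (left_mem_Icc.2 ht)
  simp only [H.flow_zero hx.1, cumRate, intervalIntegral.integral_same] at hzero ⊢
  linarith

end IsCharacteristics

end CumRate

section Hazard

variable {φ : ℝ → ℝ → ℝ} {f m M lam : ℝ → ℝ} {κ r L a b : ℝ}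

namespace IsCharacteristics

theorem jump_inv (H : IsCharacteristics φ f) {u : ℝ} (hu : 0 ≤ u) : f (inv f u) = u :=
  apply_inv H.jump_diffeo.bijOn.surjOn hu

theorem inv_jump_pos (H : IsCharacteristics φ f) {u : ℝ} (hu : 0 < u) : 0 < inv f u := by
  refine lt_of_le_of_ne (inv_nonneg H.jump_diffeo.bijOn.surjOn hu.le) fun hzero => ?_
  have hfu := H.jump_inv hu.le
  rw [← hzero, H.jump_zero] at hfu
  exact hu.ne hfu

theorem hazardRate_nonneg (H : IsCharacteristics φ f) (hcon : IsConstrained φ f m M κ)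
    (hlam : ∀ x ≥ 0, 0 ≤ lam x) (u : ℝ) : 0 ≤ hazardRate φ f lam u :=
  indicator_nonneg (fun _ hu => mul_nonneg
    (hcon.g_pos (H.inv_jump_pos hu) (H.jump_inv (le_of_lt hu)).le).le
    (hlam _ (H.inv_jump_pos hu).le)) u

theorem hazardRate_le (H : IsCharacteristics φ f) (hcon : IsConstrained φ f m M κ)
    (hlam : ∀ x ≥ 0, 0 ≤ lam x) {u : ℝ} (hu : 0 < u) :
    hazardRate φ f lam u ≤ M u * lam (inv f u) := by
  rw [hazardRate, indicator_of_mem (mem_Ioi.2 hu)]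
  exact mul_le_mul_of_nonneg_right (hcon.g_le_M _ (H.inv_jump_pos hu) u (H.jump_inv hu.le).le)
    (hlam _ (H.inv_jump_pos hu).le)

theorem mul_rpow_le_hazardRate (H : IsCharacteristics φ f) (hcon : IsConstrained φ f m M κ)
    (hr : 0 < r) (ha : 0 < a) (hlam : RateClass f m M r L a b lam) {u : ℝ} (hu : f r ≤ u) :
    a * u ^ b ≤ hazardRate φ f lam u := by
  have hu0 : 0 < u := (hcon.jump_pos r hr).trans_le hu
  have hx := H.inv_jump_pos hu0
  have hlower := hlam.lower_bound (inv f u)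
    ((H.jump_le_jump_iff hr.le hx.le).1 (by rwa [H.jump_inv hu0.le]))
  rw [H.jump_inv hu0.le, div_le_div_iff₀ (hcon.m_pos u hu0) ha] at hlower
  rw [hazardRate, indicator_of_mem (mem_Ioi.2 hu0)]
  calc a * u ^ b = u ^ b * a := mul_comm _ _
    _ ≤ lam (inv f u) * m u := hlower
    _ ≤ lam (inv f u) * g φ f (inv f u) u :=
        mul_le_mul_of_nonneg_left (hcon.m_le_g _ hx u (H.jump_inv hu0.le).le) (hlam.nonneg _ hx.le)
    _ = g φ f (inv f u) u * lam (inv f u) := mul_comm _ _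

theorem integrableOn_hazardRate_Icc (H : IsCharacteristics φ f) (hcon : IsConstrained φ f m M κ)
    (hlam : ContinuousOn lam (Ici 0)) {u : ℝ} (hu : 0 < u) (v : ℝ) :
    IntegrableOn (hazardRate φ f lam) (Icc u v) := by
  rcases le_or_gt u v with huv | huv
  · have hx := H.inv_jump_pos hu
    obtain ⟨t, ht, hv⟩ := H.exists_jump_flow_eq (H.isActive_of_pos hx)
      ((H.jump_inv hu.le).trans_le huv)
    have hint := (H.integrableOn_hazardRate_and_cumRate_eq hcon hlam hx ht).1
    rwa [hv, H.jump_inv hu.le] at hint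
  · rw [Icc_eq_empty huv.not_ge]
    exact integrableOn_empty

theorem aestronglyMeasurable_hazardRate (H : IsCharacteristics φ f)
    (hcon : IsConstrained φ f m M κ) (hlam : ContinuousOn lam (Ici 0)) :
    AEStronglyMeasurable (hazardRate φ f lam) (volume.restrict (Ioi 0)) := by
  refine LocallyIntegrableOn.aestronglyMeasurable fun u (hu : 0 < u) =>
    ⟨Icc (u / 2) (u + 1), mem_nhdsWithin_of_mem_nhds (Icc_mem_nhds (by linarith) (by linarith)),
      H.integrableOn_hazardRate_Icc hcon hlam (by positivity) _⟩

theorem integrableOn_hazardRate_Iic (H : IsCharacteristics φ f) (hcon : IsConstrained φ f m M κ)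
    (hr : 0 < r) (hlam : RateClass f m M r L a b lam) (v : ℝ) :
    IntegrableOn (hazardRate φ f lam) (Iic v) := by
  have hneg : IntegrableOn (hazardRate φ f lam) (Iic 0) :=
    integrableOn_zero.congr_fun (fun u hu => (indicator_of_notMem (not_lt.2 hu) _).symm)
      measurableSet_Iic
  have hnear : IntegrableOn (hazardRate φ f lam) (Ioc 0 (f r)) := by
    refine Integrable.mono' hlam.integrableOn ((H.aestronglyMeasurable_hazardRate hcon
      hlam.continuousOn).mono_set Ioc_subset_Ioi_self) ?_
    filter_upwards [ae_restrict_mem measurableSet_Ioc] with u hu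
    rw [Real.norm_eq_abs, abs_of_nonneg (H.hazardRate_nonneg hcon hlam.nonneg u)]
    exact H.hazardRate_le hcon hlam.nonneg hu.1
  have hfar := H.integrableOn_hazardRate_Icc hcon hlam.continuousOn (hcon.jump_pos r hr) v
  refine ((hneg.union hnear).union hfar).mono_set fun u (hu : u ≤ v) => ?_
  rw [Iic_union_Ioc_eq_Iic (hcon.jump_pos r hr).le]
  exact (le_total u (f r)).imp id fun hle => ⟨hle, hu⟩

theorem intervalIntegrable_hazardRate (H : IsCharacteristics φ f)
    (hcon : IsConstrained φ f m M κ) (hr : 0 < r) (hlam : RateClass f m M r L a b lam) (u v : ℝ) :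
    IntervalIntegrable (hazardRate φ f lam) volume u v :=
  ⟨(H.integrableOn_hazardRate_Iic hcon hr hlam v).mono_set fun _ h => h.2,
    (H.integrableOn_hazardRate_Iic hcon hr hlam u).mono_set fun _ h => h.2⟩

end IsCharacteristics

/-- A function `C` of the position after a jump whose increments are the cumulated jump rate along
the flow. It varies by at most `L` below `f r`, and grows at least like `θ y ^ p` above `f r`. -/
structure IsHazard (φ : ℝ → ℝ → ℝ) (f lam : ℝ → ℝ) (r θ p L : ℝ) (C : ℝ → ℝ) : Prop where
  continuous : Continuous C
  monotone : Monotone C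
  zero : C 0 = 0
  le : C (f r) ≤ L
  increment_le : ∀ y₁ ≥ f r, ∀ y₂ ≥ y₁, θ * (y₂ ^ p - y₁ ^ p) ≤ C y₂ - C y₁
  cumRate_eq : ∀ x, IsActive φ x → ∀ t ≥ 0, cumRate φ lam x t = C (f (φ x t)) - C (f x)

/-- The primitive of the hazard rate. -/
noncomputable def hazard (φ : ℝ → ℝ → ℝ) (f lam : ℝ → ℝ) (y : ℝ) : ℝ :=
  ∫ u in (0 : ℝ)..y, hazardRate φ f lam u

namespace IsCharacteristics

theorem continuous_hazard (H : IsCharacteristics φ f) (hcon : IsConstrained φ f m M κ) (hr : 0 < r)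
    (hlam : RateClass f m M r L a b lam) : Continuous (hazard φ f lam) :=
  intervalIntegral.continuous_primitive (H.intervalIntegrable_hazardRate hcon hr hlam) 0

theorem hazard_sub (H : IsCharacteristics φ f) (hcon : IsConstrained φ f m M κ) (hr : 0 < r)
    (hlam : RateClass f m M r L a b lam) (u v : ℝ) :
    hazard φ f lam v - hazard φ f lam u = ∫ z in u..v, hazardRate φ f lam z :=
  intervalIntegral.integral_interval_sub_left (H.intervalIntegrable_hazardRate hcon hr hlam _ _)
    (H.intervalIntegrable_hazardRate hcon hr hlam _ _)

theorem hazard_jump_le (H : IsCharacteristics φ f) (hcon : IsConstrained φ f m M κ) (hr : 0 < r)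
    (hlam : RateClass f m M r L a b lam) : hazard φ f lam (f r) ≤ L := by
  have hfr := (hcon.jump_pos r hr).le
  refine le_trans ?_ hlam.integral_le
  rw [hazard, intervalIntegral.integral_of_le hfr, intervalIntegral.integral_of_le hfr]
  exact setIntegral_mono_on (H.intervalIntegrable_hazardRate hcon hr hlam 0 (f r)).1
    hlam.integrableOn measurableSet_Ioc fun u hu => H.hazardRate_le hcon hlam.nonneg hu.1

theorem mul_rpow_sub_le_hazard_sub (H : IsCharacteristics φ f) (hcon : IsConstrained φ f m M κ)
    (hr : 0 < r) (ha : 0 < a) (hb : -1 < b) (hlam : RateClass f m M r L a b lam) {u v : ℝ}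
    (hu : f r ≤ u) (huv : u ≤ v) :
    a / (b + 1) * (v ^ (b + 1) - u ^ (b + 1)) ≤ hazard φ f lam v - hazard φ f lam u := by
  calc a / (b + 1) * (v ^ (b + 1) - u ^ (b + 1)) = ∫ z in u..v, a * z ^ b := by
        rw [intervalIntegral.integral_const_mul, integral_rpow (Or.inl hb)]
        ring
    _ ≤ ∫ z in u..v, hazardRate φ f lam z :=
        intervalIntegral.integral_mono_on huv
          ((intervalIntegral.intervalIntegrable_rpow' hb).const_mul a)
          (H.intervalIntegrable_hazardRate hcon hr hlam _ _) fun z hz =>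
            H.mul_rpow_le_hazardRate hcon hr ha hlam (hu.trans hz.1)
    _ = hazard φ f lam v - hazard φ f lam u := (H.hazard_sub hcon hr hlam u v).symm

theorem isHazard_hazard (H : IsCharacteristics φ f) (hcon : IsConstrained φ f m M κ) (hr : 0 < r)
    (ha : 0 < a) (hb : -1 < b) (hlam : RateClass f m M r L a b lam) :
    IsHazard φ f lam r (a / (b + 1)) (b + 1) L (hazard φ f lam) where
  continuous := H.continuous_hazard hcon hr hlam
  monotone u v huv := by
    rw [← sub_nonneg, H.hazard_sub hcon hr hlam]
    exact intervalIntegral.integral_nonneg_of_forall huv (H.hazardRate_nonneg hcon hlam.nonneg)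
  zero := intervalIntegral.integral_same
  le := H.hazard_jump_le hcon hr hlam
  increment_le _ hu _ huv := H.mul_rpow_sub_le_hazard_sub hcon hr ha hb hlam hu huv
  cumRate_eq x hx t ht := by
    refine H.cumRate_eq_of_forall_pos hlam.continuousOn (H.continuous_hazard hcon hr hlam)
      (fun x hx t ht => ?_) hx ht
    have hle : f x ≤ f (φ x t) := by
      simpa only [H.flow_zero hx.le] using
        (H.strictMonoOn_jump_flow (H.isActive_of_pos hx)).monotoneOn self_mem_Ici ht ht
    rw [H.hazard_sub hcon hr hlam, intervalIntegral.integral_of_le hle,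
      (H.integrableOn_hazardRate_and_cumRate_eq hcon hlam.continuousOn hx ht).2,
      integral_Icc_eq_integral_Ioc]

end IsCharacteristics

end Hazard

section LeftInverse

/-- The left-continuous inverse on `[0,∞)` of an unbounded increasing function. -/
noncomputable def leftInv (C : ℝ → ℝ) (c : ℝ) : ℝ := sInf {y | 0 ≤ y ∧ c ≤ C y}

variable {C : ℝ → ℝ}

theorem isLeast_leftInv (hC : Continuous C) (htop : Filter.Tendsto C Filter.atTop Filter.atTop)
    (c : ℝ) : IsLeast {y | 0 ≤ y ∧ c ≤ C y} (leftInv C c) := by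
  have hbdd : BddBelow {y | 0 ≤ y ∧ c ≤ C y} := ⟨0, fun _ hy => hy.1⟩
  have hclosed : IsClosed {y | 0 ≤ y ∧ c ≤ C y} :=
    isClosed_Ici.inter (isClosed_Ici.preimage hC)
  have hne : {y | 0 ≤ y ∧ c ≤ C y}.Nonempty :=
    ((Filter.eventually_ge_atTop 0).and (htop.eventually_ge_atTop c)).exists
  exact ⟨hclosed.csInf_mem hne hbdd, fun y hy => csInf_le hbdd hy⟩

theorem monotone_leftInv (hC : Continuous C)
    (htop : Filter.Tendsto C Filter.atTop Filter.atTop) : Monotone (leftInv C) := fun _ c hc =>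
  (isLeast_leftInv hC htop _).2 ((isLeast_leftInv hC htop c).1.imp_right hc.trans)

theorem apply_leftInv (hC : Continuous C) (htop : Filter.Tendsto C Filter.atTop Filter.atTop)
    {c : ℝ} (hc : C 0 ≤ c) : C (leftInv C c) = c := by
  obtain ⟨⟨hnonneg, hle⟩, hleast⟩ := isLeast_leftInv hC htop c
  obtain ⟨y, hy, hyc⟩ := intermediate_value_Icc hnonneg hC.continuousOn ⟨hc, hle⟩
  rw [le_antisymm (hleast ⟨hy.1, hyc.ge⟩) hy.2, hyc]

end LeftInverse

section JumpChain

variable {φ : ℝ → ℝ → ℝ} {f m M lam C V : ℝ → ℝ} {κ r θ p L ρ v₀ : ℝ}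

theorem IsHazard.tendsto_atTop (hC : IsHazard φ f lam r θ p L C) (hθ : 0 < θ) (hp : 0 < p) :
    Filter.Tendsto C Filter.atTop Filter.atTop := by
  have hpower : Filter.Tendsto (fun y : ℝ => θ * (y ^ p - f r ^ p) + C (f r))
      Filter.atTop Filter.atTop :=
    Filter.tendsto_atTop_add_const_right _ _ ((Filter.tendsto_atTop_add_const_right _ _
      (tendsto_rpow_atTop hp)).const_mul_atTop hθ)
  refine Filter.tendsto_atTop_mono' _ ?_ hpower
  filter_upwards [Filter.eventually_ge_atTop (f r)] with y hy
  linarith [hC.increment_le (f r) le_rfl y hy]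

theorem IsHazard.lt_leftInv_add (hC : IsHazard φ f lam r θ p L C)
    (htop : Filter.Tendsto C Filter.atTop Filter.atTop) (y : ℝ) {e : ℝ} (he : 0 < e) :
    y < leftInv C (C y + e) := by
  by_contra! hle
  linarith [hC.monotone hle, (isLeast_leftInv hC.continuous htop (C y + e)).1.2]

theorem IsHazard.jump_flow_waitingTime (hC : IsHazard φ f lam r θ p L C)
    (H : IsCharacteristics φ f) (htop : Filter.Tendsto C Filter.atTop Filter.atTop) {x e : ℝ}
    (hx : IsActive φ x) (he : 0 < e) :
    f (φ x (waitingTime φ lam x e)) = leftInv C (C (f x) + e) := by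
  obtain ⟨t, ht, hty⟩ := H.exists_jump_flow_eq hx (hC.lt_leftInv_add htop (f x) he).le
  obtain ⟨⟨-, hle⟩, hleast⟩ := isLeast_leftInv hC.continuous htop (C (f x) + e)
  have ht_least : IsLeast {t : ℝ | 0 ≤ t ∧ e ≤ cumRate φ lam x t} t := by
    refine ⟨⟨ht, ?_⟩, fun s ⟨hs, hes⟩ => ?_⟩
    · rw [hC.cumRate_eq x hx t ht, hty]
      linarith
    · rw [hC.cumRate_eq x hx s hs] at hes
      refine ((H.strictMonoOn_jump_flow hx).le_iff_le ht hs).1 ?_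
      simp only [hty]
      exact hleast ⟨H.jump_nonneg (H.flow_nonneg x hx.1 s hs), by linarith⟩
  rw [waitingTime, ht_least.csInf_eq, hty]

theorem IsHazard.jumpChain_eq_recursion (hC : IsHazard φ f lam r θ p L C)
    (H : IsCharacteristics φ f) (htop : Filter.Tendsto C Filter.atTop Filter.atTop) {x : ℝ}
    (hx : IsActive φ x) {ω : ℕ → ℝ} (hω : ∀ n, 0 < ω n) (n : ℕ) :
    jumpChain φ f lam x n ω =
        recursion (levelStep (fun x => C (f (max x 0))) (leftInv C)) x n ω ∧
      IsActive φ (jumpChain φ f lam x n ω) := by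
  induction n with
  | zero => exact ⟨rfl, hx⟩
  | succ n ih =>
    obtain ⟨heq, hact⟩ := ih
    have hstep := hC.jump_flow_waitingTime H htop hact (hω n)
    simp only [jumpChain, recursion, levelStep, ← heq, max_eq_left hact.1, hstep, true_and]
    exact H.isActive_of_pos
      ((H.jump_nonneg hact.1).trans_lt (hC.lt_leftInv_add htop _ (hω n)))

theorem IsCharacteristics.jumpChain_eq_zero (H : IsCharacteristics φ f)
    (hrest : ∀ t ≥ 0, φ 0 t = 0) (lam : ℝ → ℝ) (n : ℕ) (ω : ℕ → ℝ) :
    jumpChain φ f lam 0 n ω = 0 := by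
  induction n with
  | zero => rfl
  | succ n ih =>
    have hwait : 0 ≤ waitingTime φ lam 0 (ω n) := Real.sInf_nonneg fun t ht => ht.1
    rw [jumpChain, ih, hrest _ hwait, H.jump_zero]

/-- The Lyapunov function `θ x ^ p`, made constant below `r`. -/
noncomputable def lyapunov (r θ p x : ℝ) : ℝ := θ * max x r ^ p

theorem monotone_lyapunov (hr : 0 ≤ r) (hθ : 0 ≤ θ) (hp : 0 ≤ p) : Monotone (lyapunov r θ p) :=
  fun _ _ hxy => mul_le_mul_of_nonneg_left (Real.rpow_le_rpow (hr.trans (le_max_right _ _))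
    (max_le_max_right r hxy) hp) hθ

theorem le_lyapunov (hr : 0 ≤ r) (hθ : 0 ≤ θ) (hp : 0 ≤ p) (x : ℝ) :
    θ * r ^ p ≤ lyapunov r θ p x :=
  mul_le_mul_of_nonneg_left (Real.rpow_le_rpow hr (le_max_right _ _) hp) hθ

theorem lyapunov_le_iff (hr : 0 ≤ r) (hθ : 0 < θ) (hp : 0 < p) {x : ℝ} :
    lyapunov r θ p x ≤ θ * r ^ p ↔ x ≤ r := by
  rw [lyapunov, mul_le_mul_iff_right₀ hθ,
    Real.rpow_le_rpow_iff (hr.trans (le_max_right _ _)) hr hp, max_le_iff, and_iff_left le_rfl]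

theorem mul_rpow_max_jump_le (H : IsCharacteristics φ f) (hcon : IsConstrained φ f m M κ)
    (hr : 0 < r) (hθ : 0 ≤ θ) (hp : 0 ≤ p) (x : ℝ) :
    θ * max (f (max x 0)) (f r) ^ p ≤ κ ^ p * lyapunov r θ p x := by
  have hmax : 0 ≤ max x r := hr.le.trans (le_max_right _ _)
  have hjump {y : ℝ} (hy : 0 ≤ y) (hyr : y ≤ max x r) : f y ≤ κ * max x r := by
    rcases hy.eq_or_lt with rfl | hy0
    · rw [H.jump_zero]
      exact mul_nonneg hcon.kappa_pos.le hmax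
    · exact (hcon.jump_le y hy0).trans (mul_le_mul_of_nonneg_left hyr hcon.kappa_pos.le)
  have hle : max (f (max x 0)) (f r) ≤ κ * max x r :=
    max_le (hjump (le_max_right _ _) (max_le (le_max_left _ _) hmax))
      (hjump hr.le (le_max_right _ _))
  calc θ * max (f (max x 0)) (f r) ^ p ≤ θ * (κ * max x r) ^ p := by
        have : 0 ≤ max (f (max x 0)) (f r) := (H.jump_nonneg hr.le).trans (le_max_right _ _)
        gcongr
    _ = κ ^ p * lyapunov r θ p x := by
        rw [Real.mul_rpow hcon.kappa_pos.le hmax, lyapunov, mul_left_comm]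

theorem IsHazard.mul_rpow_le_add (hC : IsHazard φ f lam r θ p L C) (hθ : 0 ≤ θ) (hp : 0 ≤ p)
    {y z : ℝ} (hz : 0 ≤ z) (hyz : C y ≤ C z) :
    θ * z ^ p ≤ θ * max y (f r) ^ p + (C z - C y) := by
  rcases le_total z (max y (f r)) with hle | hle
  · have : θ * z ^ p ≤ θ * max y (f r) ^ p := by gcongr
    linarith
  · have hinc := hC.increment_le _ (le_max_right y (f r)) z hle
    rw [mul_sub] at hinc
    linarith [hC.monotone (le_max_left y (f r))]

theorem IsHazard.lyapunov_levelStep_le (hC : IsHazard φ f lam r θ p L C)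
    (H : IsCharacteristics φ f) (hcon : IsConstrained φ f m M κ) (hr : 0 < r) (hθ : 0 < θ)
    (hp : 0 < p) (x : ℝ) {e : ℝ} (he : 0 ≤ e) :
    lyapunov r θ p (levelStep (fun x => C (f (max x 0))) (leftInv C) x e) ≤
      max (θ * r ^ p) (κ ^ p * lyapunov r θ p x + e) := by
  have htop := hC.tendsto_atTop hθ hp
  rw [levelStep]
  set y := f (max x 0)
  set z := leftInv C (C y + e)
  have hCy : C 0 ≤ C y := hC.monotone (H.jump_nonneg (le_max_right _ _))
  have hCz : C z = C y + e := apply_leftInv hC.continuous htop (by linarith)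
  rcases le_or_gt z r with hzr | hzr
  · exact le_max_of_le_left ((lyapunov_le_iff hr.le hθ hp).2 hzr)
  refine le_max_of_le_right ?_
  calc lyapunov r θ p z = θ * z ^ p := by rw [lyapunov, max_eq_left hzr.le]
    _ ≤ θ * max y (f r) ^ p + (C z - C y) :=
        hC.mul_rpow_le_add hθ.le hp.le (hr.trans hzr).le (by linarith)
    _ ≤ κ ^ p * lyapunov r θ p x + e := by
        linarith [mul_rpow_max_jump_le H hcon hr hθ.le hp.le x]

theorem IsHazard.isLyapunov (hC : IsHazard φ f lam r θ p L C) (H : IsCharacteristics φ f)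
    (hcon : IsConstrained φ f m M κ) (hr : 0 < r) (hθ : 0 < θ) (hp : 0 < p) :
    IsLyapunov (fun x => C (f (max x 0))) (leftInv C) (lyapunov r θ p) (κ ^ p) (θ * r ^ p) L where
  measurable_h := (hC.continuous.comp (H.continuousOn_jump.comp_continuous (by fun_prop)
    fun _ => mem_Ici.2 (le_max_right _ _))).measurable
  measurable_q := (monotone_leftInv hC.continuous (hC.tendsto_atTop hθ hp)).measurable
  measurable_V := (monotone_lyapunov hr.le hθ.le hp.le).measurable
  le_V := le_lyapunov hr.le hθ.le hp.le
  V_step_le x _ he := hC.lyapunov_levelStep_le H hcon hr hθ hp x he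
  level_mem x hx := by
    have hxr : max x 0 ≤ r := max_le ((lyapunov_le_iff hr.le hθ hp).1 hx) hr.le
    have hx0 : 0 ≤ max x 0 := le_max_right _ _
    exact ⟨hC.zero.ge.trans (hC.monotone (H.jump_nonneg hx0)),
      (hC.monotone ((H.jump_le_jump_iff hx0 hr.le).2 hxr)).trans hC.le⟩
  mono := (monotone_lyapunov hr.le hθ.le hp.le).comp
    (monotone_leftInv hC.continuous (hC.tendsto_atTop hθ hp))

theorem isLyapunov_const {x₀ : ℝ} (hV : Measurable V) (hle : ∀ x, v₀ ≤ V x) (hx₀ : V x₀ ≤ v₀)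
    (hL : 0 ≤ L) : IsLyapunov (fun _ => 0) (fun _ => x₀) V ρ v₀ L where
  measurable_h := measurable_const
  measurable_q := measurable_const
  measurable_V := hV
  le_V := hle
  V_step_le _ _ _ := le_max_of_le_left hx₀
  level_mem _ _ := ⟨le_rfl, hL⟩
  mono := monotone_const

theorem ae_pos_driving : ∀ᵐ ω ∂driving, ∀ n, 0 < ω n :=
  ae_all_iff.2 fun n => (measurePreserving_eval_infinitePi (fun _ => expMeasure 1)
    n).quasiMeasurePreserving.ae (ae_pos_expMeasure 1)

variable {a b : ℝ}

theorem IsCharacteristics.exists_isLyapunov_recursion (H : IsCharacteristics φ f)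
    (hcon : IsConstrained φ f m M κ) (hL : 0 ≤ L) (ha : 0 < a) (hb : -1 < b) (hr : 0 < r)
    (hlam : RateClass f m M r L a b lam) {x : ℝ} (hx : 0 ≤ x) :
    ∃ h q, IsLyapunov h q (lyapunov r (a / (b + 1)) (b + 1)) (κ ^ (b + 1))
        (a / (b + 1) * r ^ (b + 1)) L ∧
      ∀ᵐ ω ∂driving, ∀ n, jumpChain φ f lam x n ω = recursion (levelStep h q) x n ω := by
  have hp : 0 < b + 1 := by linarith
  have hθ : 0 < a / (b + 1) := div_pos ha hp
  by_cases hact : IsActive φ x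
  · have hC := H.isHazard_hazard hcon hr ha hb hlam
    refine ⟨_, _, hC.isLyapunov H hcon hr hθ hp, ?_⟩
    filter_upwards [ae_pos_driving] with ω hω n
    exact (hC.jumpChain_eq_recursion H (hC.tendsto_atTop hθ hp) hact hω n).1
  · obtain rfl : 0 = x := hx.eq_or_lt.resolve_right fun hx0 => hact (H.isActive_of_pos hx0)
    refine ⟨_, _, isLyapunov_const (monotone_lyapunov hr.le hθ.le hp.le).measurable
      (le_lyapunov hr.le hθ.le hp.le) ((lyapunov_le_iff hr.le hθ hp).2 hr.le) hL,
      .of_forall fun ω n => ?_⟩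
    rw [H.jumpChain_eq_zero (H.isActive_zero_or.resolve_left hact)]
    cases n <;> rfl

theorem IsCharacteristics.exists_forall_betaCoeff_le (H : IsCharacteristics φ f)
    (hcon : IsConstrained φ f m M κ) (hL : 0 ≤ L) (ha : 0 < a) (hb : -1 < b) (hr : 0 < r)
    {w : ℝ → ℝ} {γ A : ℝ} (hγ : 0 ≤ γ)
    (hw : IsWeight (κ ^ (b + 1)) (a / (b + 1) * r ^ (b + 1)) L w γ A) {x : ℝ} (hx : 0 ≤ x) :
    ∃ c > 0, ∀ lam, RateClass f m M r L a b lam → ∀ t,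
      betaCoeff driving (jumpChain φ f lam x) t ≤ ENNReal.ofReal (c * γ ^ t) := by
  have hp : 0 < b + 1 := by linarith
  have hκ : 0 < κ := hcon.kappa_pos
  have hρ1 : κ ^ (b + 1) < 1 := Real.rpow_lt_one hκ.le hcon.kappa_lt_one hp
  set v₀ := a / (b + 1) * r ^ (b + 1)
  have hv₀ : 0 ≤ v₀ := by positivity
  set K := 2 * (A * (1 + (lyapunov r (a / (b + 1)) (b + 1) x + (v₀ + 1) / (1 - κ ^ (b + 1)))))
  refine ⟨max 1 K, lt_max_of_lt_left one_pos, fun lam hlam t => ?_⟩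
  obtain ⟨h, q, hV, hchain⟩ := H.exists_isLyapunov_recursion hcon hL ha hb hr hlam hx
  calc betaCoeff driving (jumpChain φ f lam x) t
      = betaCoeff (iid (expMeasure 1)) (recursion (levelStep h q) x) t :=
        betaCoeff_congr_ae (P := iid (expMeasure 1)) hchain t
    _ ≤ ENNReal.ofReal (K * γ ^ t) :=
        hV.betaCoeff_le hv₀ (Real.rpow_nonneg hκ.le _) hρ1 hw hγ x t
    _ ≤ ENNReal.ofReal (max 1 K * γ ^ t) := by
        gcongr
        exact le_max_right _ _

theorem isGeometricallyBetaMixing_of_le {Ω : Type*} [MeasurableSpace Ω] {P : Measure Ω}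
    {Z : ℕ → Ω → ℝ} {c γ : ℝ} (hc : 0 < c) (hγ : 0 < γ) (hγ1 : γ < 1)
    (hZ : ∀ t, betaCoeff P Z t ≤ ENNReal.ofReal (c * γ ^ t)) :
    IsGeometricallyBetaMixing P Z := by
  refine ⟨c, hc, -Real.log γ, neg_pos.2 (Real.log_neg hγ hγ1), fun t => ?_⟩
  rw [neg_neg, mul_comm (Real.log γ), Real.exp_nat_mul, Real.exp_log hγ]
  exact hZ t

end JumpChain

end PDMP

theorem mainTheorem5_general (φ : ℝ → ℝ → ℝ) (f m M : ℝ → ℝ) (κ r L a b : ℝ)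
    (hφf : PDMP.IsCharacteristics φ f) (hcon : PDMP.IsConstrained φ f m M κ)
    (hL : 0 ≤ L) (ha : 0 < a) (hb : -1 < b) (hr : 0 < r) :
    ∃ γ : ℝ, 0 < γ ∧ γ < 1 ∧ ∀ x₀ : ℝ, 0 ≤ x₀ →
      (∀ lam : ℝ → ℝ, PDMP.RateClass f m M r L a b lam →
        PDMP.IsGeometricallyBetaMixing PDMP.driving (PDMP.jumpChain φ f lam x₀)) ∧
      ∃ c : ℝ, 0 < c ∧ ∀ t : ℕ,
        (⨆ (lam : ℝ → ℝ) (_ : PDMP.RateClass f m M r L a b lam),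
          PDMP.betaCoeff PDMP.driving (PDMP.jumpChain φ f lam x₀) t)
            ≤ ENNReal.ofReal (c * γ ^ t) := by
  have hp : 0 < b + 1 := by linarith
  have hκ : 0 < κ := hcon.kappa_pos
  obtain ⟨w, γ, A, hγ, hγ1, hw⟩ := PDMP.exists_isWeight (Real.rpow_nonneg hκ.le (b + 1))
    (Real.rpow_lt_one hκ.le hcon.kappa_lt_one hp)
    (by positivity : 0 < a / (b + 1) * r ^ (b + 1)) hL
  refine ⟨γ, hγ, hγ1, fun x₀ hx₀ => ?_⟩
  obtain ⟨c, hc, hbound⟩ := hφf.exists_forall_betaCoeff_le hcon hL ha hb hr hγ.le hw hx₀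
  exact ⟨fun lam hlam => PDMP.isGeometricallyBetaMixing_of_le hc hγ hγ1 (hbound lam hlam),
    c, hc, fun t => iSup₂_le fun lam hlam => hbound lam hlam t⟩

theorem mainTheorem5 (φ : ℝ → ℝ → ℝ) (f m M : ℝ → ℝ) (κ r L a b : ℝ)
    (hφf : PDMP.IsCharacteristics φ f) (hcon : PDMP.IsConstrained φ f m M κ)
    (hL : 0 < L) (ha : 0 < a) (hb : 0 < b) (hr : 0 < r)
    (hr' : PDMP.inv f ((-Real.log (1 - κ ^ (b + 1)) / (1 - κ ^ (b + 1))) ^ (1 / (b + 1))) ≤ r) :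
    ∃ γ : ℝ, 0 < γ ∧ γ < 1 ∧ ∀ x₀ : ℝ, 0 ≤ x₀ →
      (∀ lam : ℝ → ℝ, PDMP.RateClass f m M r L a b lam →
        PDMP.IsGeometricallyBetaMixing PDMP.driving (PDMP.jumpChain φ f lam x₀)) ∧
      ∃ c : ℝ, 0 < c ∧ ∀ t : ℕ,
        (⨆ (lam : ℝ → ℝ) (_ : PDMP.RateClass f m M r L a b lam),
          PDMP.betaCoeff PDMP.driving (PDMP.jumpChain φ f lam x₀) t)
            ≤ ENNReal.ofReal (c * γ ^ t) :=
  mainTheorem5_general φ f m M κ r L a b hφf hcon hL.le ha (by linarith) hr
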